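/- Setting. There are $n$ clients with weights $p_i\ge 0$, $\sum_{i=1}^n p_i=1$, and loss functions $\mathcal L_i:\mathbb R^d\to\mathbb R$; the federated loss is $\mathcal L=\sum_{i=1}^n p_i\mathcal L_i$, and it is bounded below by a number $\mathcal L^*$ (for instance its minimum value $\mathcal L(\theta^*)$). Fix a starting point $\theta^0\in\mathbb R^d$, learning rates $\eta_l,\eta_g>0$ and integers $K,T\ge 1$. FedAvg runs as follows. In round $t=0,1,\dots$ the server draws a client sampling outcome $S_t$, which gives client $i$ the real aggregation weight $\omega_i=\omega_i(S_t)$. Client $i$ performs $K$ local SGD steps $y_{i,0}^t=\theta^t$, $y_{i,k+1}^t=y_{i,k}^t-\eta_l\, g_i(y_{i,k}^t,\xi_{i,k}^t)$, and then $\theta^{t+1}=\theta^t+\eta_g\sum_{i=1}^n\omega_i(S_t)\,(y_{i,K}^t-\theta^t)$. The $S_t$ are identically distributed, the batches $\xi_{i,k}^t$ of client $i$ are identically distributed, and all the $S_t$ and $\xi_{i,k}^t$ are mutually independent. Assumptions. (1) Every $\mathcal L_i$ is differentiable, with an $L$-Lipschitz gradient. (2) $\mathbb E[g_i(x,\xi_i)]=\nabla\mathcal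 L_i(x)$ and $\mathbb E\|g_i(x,\xi_i)-\nabla\mathcal L_i(x)\|^2\le\sigma^2$ for all $i$ and $x$. (3) $\beta^2\ge1$, and for all $x$ and all $w_1,\dots,w_n\ge0$ with $\sum_i w_i=1$, $\ \sum_i w_i\|\nabla\mathcal L_i(x)\|^2\le\beta^2\|\nabla\mathcal L(x)\|^2+\kappa^2$. (4) The weights $\omega_i$ are square integrable, $\mathbb E[\omega_i]=p_i$, and $\mathrm{Cov}(\omega_i,\omega_j)=-\alpha p_ip_j$ for all $i\ne j$; moreover $\gamma_i:=\mathrm{Var}[\omega_i]+\alpha p_i^2\ge0$ for all $i$ (automatic if $\alpha\ge0$). (5) The learning rates are small: $2(2\beta^2+1)\eta_l^2L^2K^2<1$, $\ L\eta_g\eta_l(1-\alpha)K<1$ and $\ 3L\eta_g\eta_lK\beta^2\sum_{i}\gamma_i\le1$. Claim. There is an absolute constant $C>0$ (independent of all the data above) such that, under these assumptions, $\mathbb E\|\nabla\mathcal L(\theta^t)\|^2<\infty$ for every $t$, and $$\frac1T\sum_{t=0}^{T-1}\mathbb E\|\nabla\mathcal L(\theta^t)\|^2\le C\Big(\frac{\mathcal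 L(\theta^0)-\mathcal L^*}{\eta_g\eta_lKT}+L\,\eta_g\eta_l\sum_{i=1}^n\big[\mathrm{Var}[\omega_i]+p_i^2\big]\sigma^2+L^2\eta_l^2(K-1)\sigma^2+L^2\eta_l^2K(K-1)\kappa^2+L\,\eta_g\eta_l\Big(\sum_{i=1}^n\mathrm{Var}[\omega_i]+\alpha\sum_{i=1}^np_i^2\Big)\big[(K-1)\sigma^2+K\kappa^2\big]\Big).$$ In particular, with $L$ and $\mathcal L(\theta^0)-\mathcal L^*$ absorbed in the $\mathcal O$'s, $$\frac1T\sum_{t=0}^{T-1}\mathbb E\|\nabla\mathcal L(\theta^t)\|^2\le\mathcal O\Big(\frac1{\eta_g\eta_lKT}\Big)+\mathcal O\Big(\eta_g\eta_l\sum_{i}[\mathrm{Var}[\omega_i]+p_i^2]\sigma^2\Big)+\mathcal O\big(\eta_l^2(K-1)\sigma^2\big)+\mathcal O\big(\eta_l^2K(K-1)\kappa^2\big)+\mathcal O\Big(\eta_g\eta_l\big(\sum_i\mathrm{Var}[\omega_i]+\alpha\sum_ip_i^2\big)[(K-1)\sigma^2+K\kappa^2]\Big).$$ -/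

import Mathlib

open MeasureTheory ProbabilityTheory
open scoped Gradient NNReal

namespace FedAvg

/-- Model parameters: vectors of `ℝ^d` with the Euclidean norm. -/
abbrev Model (d : ℕ) : Type := EuclideanSpace ℝ (Fin d)

/-- The federated loss `𝓛(x) = ∑ i, p i * 𝓛_i(x)`. -/
noncomputable def fedLoss {n d : ℕ} (p : Fin n → ℝ) (loss : Fin n → Model d → ℝ)
    (x : Model d) : ℝ :=
  ∑ i, p i * loss i x

/-- The local model `y_k` of a client after `k` steps of SGD with learning rate `ηl`, started
at `x`; `g` is the stochastic gradient of the client and `ξ k` is the batch used in step `k`. -/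
noncomputable def localModel {d : ℕ} {Ξ : Type*} (g : Model d → Ξ → Model d) (ηl : ℝ)
    (ξ : ℕ → Ξ) (x : Model d) : ℕ → Model d
  | 0 => x
  | k + 1 => localModel g ηl ξ x k - ηl • g (localModel g ηl ξ x k) (ξ k)

/-- The global model `θ^t` of FedAvg after `t` rounds. In round `t` the outcome of the client
sampling is `S t`, client `i` gets the aggregation weight `wt (S t) i` and performs `K` local SGD
steps with the batches `ξ t i 0, …, ξ t i (K - 1)`, and the server aggregates the contributions
`θ_i^{t+1} - θ^t` with the global learning rate `ηg`. -/
noncomputable def globalModel {n d : ℕ} {𝒮 Ξ : Type*} (wt : 𝒮 → Fin n → ℝ)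
    (g : Fin n → Model d → Ξ → Model d) (ηg ηl : ℝ) (K : ℕ) (θ₀ : Model d)
    (S : ℕ → 𝒮) (ξ : ℕ → Fin n → ℕ → Ξ) : ℕ → Model d
  | 0 => θ₀
  | t + 1 =>
    globalModel wt g ηg ηl K θ₀ S ξ t +
      ηg • ∑ i, wt (S t) i •
        (localModel (g i) ηl (ξ t i) (globalModel wt g ηg ηl K θ₀ S ξ t) K -
          globalModel wt g ηg ηl K θ₀ S ξ t)

/-- Every client loss is differentiable with an `L`-Lipschitz gradient. -/
structure Smooth {n d : ℕ} (loss : Fin n → Model d → ℝ) (L : ℝ≥0) : Prop where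
  differentiable : ∀ i, Differentiable ℝ (loss i)
  lipschitz : ∀ i, LipschitzWith L (∇ (loss i))

/-- `g i x z` is the stochastic gradient of client `i` at the model `x` on the batch `z`, which is
drawn from `D i`. It is an unbiased estimator of `∇ 𝓛_i (x)`, with variance at most `σ²`. -/
structure UnbiasedBoundedVariance {n d : ℕ} {Ξ : Type*} [MeasurableSpace Ξ]
    (loss : Fin n → Model d → ℝ) (g : Fin n → Model d → Ξ → Model d)
    (D : Fin n → Measure Ξ) (σ : ℝ) : Prop where
  measurable : ∀ i, Measurable (fun q : Model d × Ξ => g i q.1 q.2)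
  memLp : ∀ i x, MemLp (g i x) 2 (D i)
  unbiased : ∀ i x, ∫ z, g i x z ∂(D i) = ∇ (loss i) x
  variance_le : ∀ i x, ∫ z, ‖g i x z - ∇ (loss i) x‖ ^ 2 ∂(D i) ≤ σ ^ 2

/-- Bounded gradient dissimilarity with parameters `β`, `κ`: every convex combination of the
squared norms of the client gradients is at most `β² ‖∇ 𝓛 (x)‖² + κ²`. -/
structure BoundedDissimilarity {n d : ℕ} (p : Fin n → ℝ) (loss : Fin n → Model d → ℝ)
    (β κ : ℝ) : Prop where
  one_le_sq : 1 ≤ β ^ 2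
  bound : ∀ w ∈ stdSimplex ℝ (Fin n), ∀ x,
    ∑ i, w i * ‖∇ (loss i) x‖ ^ 2 ≤ β ^ 2 * ‖∇ (fedLoss p loss) x‖ ^ 2 + κ ^ 2

/-- The client sampling has the law `ν` on the outcomes `𝒮`, and the weight of client `i` for the
outcome `s` is `wt s i`. The weights are square integrable, unbiased, and the covariance of the
weights of two distinct clients is `-α p_i p_j`. -/
structure ClientSampling {n : ℕ} {𝒮 : Type*} [MeasurableSpace 𝒮] (p : Fin n → ℝ)
    (wt : 𝒮 → Fin n → ℝ) (ν : Measure 𝒮) (α : ℝ) : Prop where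
  measurable : ∀ i, Measurable (fun s => wt s i)
  memLp : ∀ i, MemLp (fun s => wt s i) 2 ν
  unbiased : ∀ i, ∫ s, wt s i ∂ν = p i
  covariance : ∀ i j, i ≠ j → cov[fun s => wt s i, fun s => wt s j; ν] = -α * p i * p j

/-- The quantity `γ_i = Var(ω_i) + α p_i²`. -/
noncomputable def gam {n : ℕ} {𝒮 : Type*} [MeasurableSpace 𝒮] (p : Fin n → ℝ)
    (wt : 𝒮 → Fin n → ℝ) (ν : Measure 𝒮) (α : ℝ) (i : Fin n) : ℝ :=
  Var[fun s => wt s i; ν] + α * p i ^ 2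

/-- The randomness of the algorithm: the client samplings `S t` have law `ν`, the batch `ξ t i k`
of client `i` for the local step `k` of round `t` has law `D i`, and all of these random variables
are mutually independent. -/
structure Randomness {n : ℕ} {Ω 𝒮 Ξ : Type*} [MeasurableSpace Ω] [MeasurableSpace 𝒮]
    [MeasurableSpace Ξ] (P : Measure Ω) (ν : Measure 𝒮) (D : Fin n → Measure Ξ)
    (S : ℕ → Ω → 𝒮) (ξ : ℕ → Fin n → ℕ → Ω → Ξ) : Prop where
  measurable_sampling : ∀ t, Measurable (S t)
  measurable_batch : ∀ t i k, Measurable (ξ t i k)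
  law_sampling : ∀ t, P.map (S t) = ν
  law_batch : ∀ t i k, P.map (ξ t i k) = D i
  iIndep_sampling : iIndepFun S P
  iIndep_batch : iIndepFun (fun (q : ℕ × Fin n × ℕ) => ξ q.1 q.2.1 q.2.2) P
  indep : IndepFun (fun a t => S t a) (fun a (q : ℕ × Fin n × ℕ) => ξ q.1 q.2.1 q.2.2 a) P

end FedAvg

/-! Fix the model `x` at the start of a round, let `G` be the gradient of the federated loss there,
and let `m i` be the mean displacement of client `i` after its local steps. The independence of the
weights from the displacements, and of the displacements from each other, together with the special
form of the covariances, gives the aggregate the mean `M = ∑ p i • m i` and the exact second moment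
`(1 - α)‖M‖²`, plus a noise part weighted by `Var + p i ^ 2`, plus `∑ γ_i ‖m i‖²`
(`integral_norm_sq_aggregate`).

The quadratic upper bound for the loss then needs only two inputs. Polarization of `⟨G, M⟩` around
the ideal displacement `-(ηl * K) • G` yields the decrease in `‖G‖²`, a deviation `‖M + (ηl * K) •
G‖²`, and a negative multiple of `‖M‖²` that absorbs `(1 - α)‖M‖²` by the second smallness
condition. What remains is to control each client's deviation, progress and noise.

For this, the local model is split into its mean and its variance. The variance satisfies a linear
recursion, because a step is a Lipschitz map plus orthogonal noise; hence it is `O(k η² σ²)`. The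
mean moves by averaged gradients, which differ from the initial gradient by at most `L` times the
root mean squared distance from `x`. Thus noise enters the mean only through the curvature, with a
factor `K - 1`, since the first gradient is evaluated at `x` itself
(`IsClient.sq_norm_localMean_sub_le`, `IsClient.sq_norm_localMean_sub_add_le`). Bounded
dissimilarity, used with the weights `p` and with the normalized `γ`, turns client gradients into
`G`, and `round_arithmetic` shows that a fixed fraction of the decrease survives.

Finally, the randomness of a round is independent of its starting model, so Fubini turns the
estimate at fixed `x` into one for expectations, and the estimates telescope. Square integrability
is propagated through the rounds to make these integrals legitimate. -/

namespace FedAvg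

/-! ### Independence and Fubini -/

section Independence

variable {Ω : Type*} {mΩ : MeasurableSpace Ω} {P : Measure Ω}

/-- Two independent families of independent σ-algebras form one independent family. -/
theorem iIndep_sumElim {ι κ : Type*} {m₁ : ι → MeasurableSpace Ω} {m₂ : κ → MeasurableSpace Ω}
    (h₁ : iIndep m₁ P) (h₂ : iIndep m₂ P) (h : Indep (⨆ i, m₁ i) (⨆ j, m₂ j) P) :
    iIndep (Sum.elim m₁ m₂) P := by
  rw [iIndep_iff]
  intro s f hf
  have key : (⋂ i ∈ s, f i) =
      (⋂ i ∈ s.toLeft, f (Sum.inl i)) ∩ (⋂ j ∈ s.toRight, f (Sum.inr j)) := by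
    ext a
    simp [Finset.mem_toLeft, Finset.mem_toRight]
  have hl : ∀ i ∈ s.toLeft, MeasurableSet[m₁ i] (f (Sum.inl i)) := fun i hi =>
    hf (Sum.inl i) (Finset.mem_toLeft.1 hi)
  have hr : ∀ j ∈ s.toRight, MeasurableSet[m₂ j] (f (Sum.inr j)) := fun j hj =>
    hf (Sum.inr j) (Finset.mem_toRight.1 hj)
  rw [key, (Indep_iff _ _ _).1 h _ _
      (Finset.measurableSet_biInter _ fun i hi => le_iSup m₁ i _ (hl i hi))
      (Finset.measurableSet_biInter _ fun j hj => le_iSup m₂ j _ (hr j hj)),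
    h₁.meas_biInter hl, h₂.meas_biInter hr]
  conv_rhs => rw [← Finset.toLeft_disjSum_toRight (u := s)]
  rw [Finset.prod_disjSum]

/-- Random variables that depend on disjoint parts of an independent family are independent. -/
theorem indepFun_of_measurable_biSup {ι β γ : Type*} [MeasurableSpace β] [MeasurableSpace γ]
    {m : ι → MeasurableSpace Ω} (hm : ∀ i, m i ≤ mΩ) (h : iIndep m P) {A B : Set ι}
    (hAB : Disjoint A B) {X : Ω → β} {Y : Ω → γ} (hX : Measurable[⨆ i ∈ A, m i] X)
    (hY : Measurable[⨆ i ∈ B, m i] Y) : IndepFun X Y P := by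
  rw [IndepFun_iff_Indep]
  exact indep_of_indep_of_le_left (indep_of_indep_of_le_right
    (indep_iSup_of_disjoint hm h hAB) hY.comap_le) hX.comap_le

theorem measurable_biSup_of_comap_le {ι β : Type*} [mβ : MeasurableSpace β]
    {m : ι → MeasurableSpace Ω} {A : Set ι} {i : ι} (hi : i ∈ A) {X : Ω → β}
    (hX : mβ.comap X ≤ m i) : Measurable[⨆ i ∈ A, m i] X :=
  Measurable.of_comap_le (hX.trans (le_biSup m hi))

/-- Fubini's theorem for a function of two independent random variables. -/
theorem integral_comp_of_indepFun {A B E : Type*} [MeasurableSpace A] [MeasurableSpace B]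
    [NormedAddCommGroup E] [NormedSpace ℝ E] [IsProbabilityMeasure P]
    {X : Ω → A} {Y : Ω → B} (hX : Measurable X) (hY : Measurable Y) (h : IndepFun X Y P)
    {F : A × B → E} (hF : StronglyMeasurable F) (hint : Integrable (fun a => F (X a, Y a)) P) :
    Integrable (fun a => ∫ b, F (X a, Y b) ∂P) P ∧
      ∫ a, F (X a, Y a) ∂P = ∫ a, (∫ b, F (X a, Y b) ∂P) ∂P := by
  have hmap := (indepFun_iff_map_prod_eq_prod_map_map hX.aemeasurable hY.aemeasurable).1 h
  have := Measure.isProbabilityMeasure_map (μ := P) hX.aemeasurable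
  have := Measure.isProbabilityMeasure_map (μ := P) hY.aemeasurable
  have hint' : Integrable F ((P.map X).prod (P.map Y)) := by
    rw [← hmap, integrable_map_measure hF.aestronglyMeasurable (hX.prodMk hY).aemeasurable]
    exact hint
  have hin : ∀ x, ∫ y, F (x, y) ∂(P.map Y) = ∫ b, F (x, Y b) ∂P := fun x =>
    integral_map hY.aemeasurable
      (hF.comp_measurable measurable_prodMk_left).aestronglyMeasurable
  have h1 := hint'.integral_prod_left
  simp_rw [hin] at h1
  refine ⟨(integrable_map_measure h1.aestronglyMeasurable hX.aemeasurable).1 h1, ?_⟩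
  calc ∫ a, F (X a, Y a) ∂P = ∫ z, F z ∂(P.map fun a => (X a, Y a)) :=
        (integral_map (hX.prodMk hY).aemeasurable hF.aestronglyMeasurable).symm
    _ = ∫ x, (∫ b, F (x, Y b) ∂P) ∂(P.map X) := by
        rw [hmap, integral_prod _ hint']
        simp_rw [hin]
    _ = ∫ a, (∫ b, F (X a, Y b) ∂P) ∂P := integral_map hX.aemeasurable h1.aestronglyMeasurable

/-- A function of two independent random variables is square integrable if the second moments of
its sections are dominated by an integrable function of the first one. -/
theorem memLp_two_comp_of_indepFun {A B E : Type*} [MeasurableSpace A] [MeasurableSpace B]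
    [NormedAddCommGroup E] [IsProbabilityMeasure P]
    {X : Ω → A} {Y : Ω → B} (hX : Measurable X) (hY : Measurable Y) (h : IndepFun X Y P)
    {F : A × B → E} (hF : StronglyMeasurable F)
    (hsec : ∀ x, MemLp (fun b => F (x, Y b)) 2 P) {q : A → ℝ} (hq : Measurable q)
    (hqi : Integrable (fun a => q (X a)) P) (hle : ∀ x, ∫ b, ‖F (x, Y b)‖ ^ 2 ∂P ≤ q x) :
    MemLp (fun a => F (X a, Y a)) 2 P := by
  have hmap := (indepFun_iff_map_prod_eq_prod_map_map hX.aemeasurable hY.aemeasurable).1 h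
  have := Measure.isProbabilityMeasure_map (μ := P) hX.aemeasurable
  have := Measure.isProbabilityMeasure_map (μ := P) hY.aemeasurable
  have hXY := hX.prodMk hY
  have hF2 : StronglyMeasurable (fun z => ‖F z‖ ^ 2) := hF.norm.pow 2
  refine (memLp_two_iff_integrable_sq_norm (hF.comp_measurable hXY).aestronglyMeasurable).2 ?_
  suffices Integrable (fun z => ‖F z‖ ^ 2) (P.map fun a => (X a, Y a)) from
    (integrable_map_measure hF2.aestronglyMeasurable hXY.aemeasurable).1 this
  have hin : ∀ x, ∫ y, ‖F (x, y)‖ ^ 2 ∂(P.map Y) = ∫ b, ‖F (x, Y b)‖ ^ 2 ∂P := fun x =>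
    integral_map hY.aemeasurable
      (hF2.comp_measurable measurable_prodMk_left).aestronglyMeasurable
  rw [hmap, integrable_prod_iff hF2.aestronglyMeasurable]
  refine ⟨Filter.Eventually.of_forall fun x => ?_, ?_⟩
  · refine (integrable_map_measure
      (hF2.comp_measurable measurable_prodMk_left).aestronglyMeasurable hY.aemeasurable).2 ?_
    exact (memLp_two_iff_integrable_sq_norm (hsec x).1).1 (hsec x)
  · have hqm : Integrable q (P.map X) :=
      (integrable_map_measure hq.aestronglyMeasurable hX.aemeasurable).2 hqi
    refine hqm.mono' (hF2.norm.integral_prod_right).aestronglyMeasurable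
      (Filter.Eventually.of_forall fun x => ?_)
    simp only [norm_pow, norm_norm]
    rw [Real.norm_of_nonneg (integral_nonneg fun _ => by positivity), hin]
    exact hle x

end Independence

/-! ### Second moments in Hilbert spaces -/

section Hilbert

variable {Ω E : Type*} {mΩ : MeasurableSpace Ω} {P : Measure Ω} [NormedAddCommGroup E]

theorem integrable_norm_sq_of_memLp_two {X : Ω → E} (hX : MemLp X 2 P) :
    Integrable (fun a => ‖X a‖ ^ 2) P :=
  (memLp_two_iff_integrable_sq_norm hX.1).1 hX

theorem integrable_inner_of_memLp_two [InnerProductSpace ℝ E] {X Y : Ω → E} (hX : MemLp X 2 P) (hY : MemLp Y 2 P) :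
    Integrable (fun a => inner ℝ (X a) (Y a)) P := by
  refine ((integrable_norm_sq_of_memLp_two hX).add (integrable_norm_sq_of_memLp_two hY)).mono'
    (hX.1.inner hY.1) (Filter.Eventually.of_forall fun a => ?_)
  have h1 := norm_inner_le_norm (𝕜 := ℝ) (X a) (Y a)
  simp only [Pi.add_apply, Real.norm_eq_abs] at h1 ⊢
  nlinarith [sq_nonneg (‖X a‖ - ‖Y a‖), sq_nonneg (‖X a‖ + ‖Y a‖)]

section

variable [IsProbabilityMeasure P] [InnerProductSpace ℝ E] [CompleteSpace E]

/-- The bias-variance decomposition of the mean squared distance to a point. -/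
theorem integral_norm_sub_sq {X : Ω → E} (hX : MemLp X 2 P) (c : E) :
    ∫ a, ‖X a - c‖ ^ 2 ∂P = ∫ a, ‖X a - ∫ b, X b ∂P‖ ^ 2 ∂P + ‖(∫ b, X b ∂P) - c‖ ^ 2 := by
  set e := ∫ b, X b ∂P with he
  have hXi : Integrable X P := hX.integrable (by norm_num)
  have hc : MemLp (fun a => X a - e) 2 P := hX.sub (memLp_const e)
  have h1 : ∀ a, ‖X a - c‖ ^ 2 =
      ‖X a - e‖ ^ 2 + (2 * inner ℝ (e - c) (X a - e) + ‖e - c‖ ^ 2) := fun a => by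
    have : X a - c = (X a - e) + (e - c) := by abel
    rw [this, norm_add_sq_real, real_inner_comm]
    ring
  have h2 : Integrable (fun a => inner ℝ (e - c) (X a - e)) P :=
    (hc.integrable (by norm_num)).const_inner _
  have h3 : ∫ a, inner ℝ (e - c) (X a - e) ∂P = 0 := by
    rw [integral_inner (hc.integrable (by norm_num)), integral_sub hXi (integrable_const _)]
    simp [he]
  simp_rw [h1]
  rw [integral_add (integrable_norm_sq_of_memLp_two hc)
      (by exact (h2.const_mul 2).add (integrable_const _)),
    integral_add (h2.const_mul 2) (integrable_const _), integral_const_mul, h3]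
  simp

theorem integral_norm_sub_integral_sq_le {X : Ω → E} (hX : MemLp X 2 P) (c : E) :
    ∫ a, ‖X a - ∫ b, X b ∂P‖ ^ 2 ∂P ≤ ∫ a, ‖X a - c‖ ^ 2 ∂P := by
  rw [integral_norm_sub_sq hX c]
  exact le_add_of_nonneg_right (by positivity)

end

/-- The difference of the two sides is the variance of the scalar `‖X‖`. -/
theorem sq_integral_norm_le [IsProbabilityMeasure P] {X : Ω → E} (hX : MemLp X 2 P) :
    (∫ a, ‖X a‖ ∂P) ^ 2 ≤ ∫ a, ‖X a‖ ^ 2 ∂P := by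
  have h := integral_norm_sub_sq hX.norm (0 : ℝ)
  simp only [sub_zero, Real.norm_eq_abs, sq_abs] at h
  rw [h]
  exact le_add_of_nonneg_left (integral_nonneg fun _ => by positivity)

end Hilbert

/-! ### Convexity of the squared norm -/

section Convexity

theorem sq_norm_sum_smul_le {ι E : Type*} [Fintype ι] [NormedAddCommGroup E]
    [InnerProductSpace ℝ E] {p : ι → ℝ} (hp : p ∈ stdSimplex ℝ ι) (v : ι → E) :
    ‖∑ i, p i • v i‖ ^ 2 ≤ ∑ i, p i * ‖v i‖ ^ 2 := by
  have h := (convexOn_univ_norm (E := E)).pow (fun _ _ => norm_nonneg _) 2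
  simpa using h.map_sum_le (t := Finset.univ) (fun i _ => hp.1 i) hp.2
    (fun i _ => Set.mem_univ (v i))

end Convexity

/-! ### Lipschitz gradients and the descent inequality -/

section Smoothness

variable {E : Type*} [NormedAddCommGroup E] [InnerProductSpace ℝ E] [CompleteSpace E]

/-- The quadratic upper bound of a function with Lipschitz gradient. -/
theorem le_of_lipschitzWith_gradient {f : E → ℝ} {L : ℝ≥0} (hf : Differentiable ℝ f)
    (hL : LipschitzWith L (∇ f)) (x v : E) :
    f (x + v) ≤ f x + inner ℝ (∇ f x) v + L / 2 * ‖v‖ ^ 2 := by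
  have hline : ∀ t : ℝ, HasDerivAt (fun t : ℝ => x + t • v) v t := fun t => by
    simpa using ((hasDerivAt_id t).smul_const v).const_add x
  have hd : ∀ t : ℝ, HasDerivAt (fun t : ℝ => f (x + t • v)) (inner ℝ (∇ f (x + t • v)) v) t := by
    intro t
    have h := (hf (x + t • v)).hasGradientAt.hasFDerivAt.comp_hasDerivAt t (hline t)
    exact h.congr_deriv (by simp)
  -- A quadratic majorant along the segment: it agrees with `f` at `t = 0` and its derivative
  -- dominates that of `f` on `[0, 1]`.
  let B : ℝ → ℝ := fun t => f x + t * inner ℝ (∇ f x) v + L / 2 * ‖v‖ ^ 2 * t ^ 2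
  have hB : ∀ t : ℝ, HasDerivAt B (inner ℝ (∇ f x) v + L * ‖v‖ ^ 2 * t) t := fun t => by
    have h := (((hasDerivAt_id t).mul_const (inner ℝ (∇ f x) v)).const_add (f x)).add
      ((hasDerivAt_pow 2 t).const_mul (L / 2 * ‖v‖ ^ 2))
    refine h.congr_deriv ?_
    simp
    ring
  have key := image_le_of_deriv_right_le_deriv_boundary (a := (0 : ℝ)) (b := 1)
    (f := fun t : ℝ => f (x + t • v)) (B := B)
    (fun t _ => (hd t).continuousAt.continuousWithinAt) (fun t _ => (hd t).hasDerivWithinAt)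
    (by simp [B]) (fun t _ => (hB t).continuousAt.continuousWithinAt)
    (fun t _ => (hB t).hasDerivWithinAt) (fun t ht => by
      have h1 : inner ℝ (∇ f (x + t • v) - ∇ f x) v ≤ L * ‖v‖ ^ 2 * t := by
        calc inner ℝ (∇ f (x + t • v) - ∇ f x) v ≤ ‖∇ f (x + t • v) - ∇ f x‖ * ‖v‖ :=
              real_inner_le_norm _ _
          _ ≤ (L * (t * ‖v‖)) * ‖v‖ := by
              gcongr
              have := hL.norm_sub_le (x + t • v) x
              simpa [norm_smul, abs_of_nonneg ht.1] using this
          _ = L * ‖v‖ ^ 2 * t := by ring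
      rw [inner_sub_left] at h1
      linarith)
    (Set.right_mem_Icc.2 zero_le_one)
  simpa [B] using key

theorem hasGradientAt_fedLoss {n d : ℕ} (p : Fin n → ℝ) {loss : Fin n → Model d → ℝ} {L : ℝ≥0}
    (h : Smooth loss L) (x : Model d) :
    HasGradientAt (fedLoss p loss) (∑ i, p i • ∇ (loss i) x) x := by
  rw [hasGradientAt_iff_hasFDerivAt]
  have := HasFDerivAt.fun_sum (u := Finset.univ) fun i _ =>
    (((h.differentiable i) x).hasGradientAt.hasFDerivAt).const_mul (p i)
  exact this.congr_fderiv (by simp [map_sum])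

theorem gradient_fedLoss {n d : ℕ} (p : Fin n → ℝ) {loss : Fin n → Model d → ℝ} {L : ℝ≥0}
    (h : Smooth loss L) (x : Model d) : ∇ (fedLoss p loss) x = ∑ i, p i • ∇ (loss i) x :=
  (hasGradientAt_fedLoss p h x).gradient

theorem lipschitzWith_gradient_fedLoss {n d : ℕ} {p : Fin n → ℝ} (hp : p ∈ stdSimplex ℝ (Fin n))
    {loss : Fin n → Model d → ℝ} {L : ℝ≥0} (h : Smooth loss L) :
    LipschitzWith L (∇ (fedLoss p loss)) := by
  refine LipschitzWith.of_dist_le_mul fun x y => ?_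
  rw [dist_eq_norm, dist_eq_norm, gradient_fedLoss p h, gradient_fedLoss p h,
    ← Finset.sum_sub_distrib]
  calc ‖∑ i, (p i • ∇ (loss i) x - p i • ∇ (loss i) y)‖
      ≤ ∑ i, p i * (L * ‖x - y‖) := by
        refine norm_sum_le_of_le _ fun i _ => ?_
        rw [← smul_sub, norm_smul, Real.norm_of_nonneg (hp.1 i)]
        exact mul_le_mul_of_nonneg_left ((h.lipschitz i).norm_sub_le x y) (hp.1 i)
    _ = L * ‖x - y‖ := by rw [← Finset.sum_mul, hp.2, one_mul]

end Smoothness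

/-! ### One step of stochastic gradient descent -/

section StochasticGradient

variable {d : ℕ} {Ω Ξ : Type*} {mΩ : MeasurableSpace Ω} [MeasurableSpace Ξ] {P : Measure Ω}
  {G : Model d → Model d} {g : Model d → Ξ → Model d} {D : Measure Ξ} {L : ℝ≥0} {σ : ℝ}

theorem memLp_two_comp_of_lipschitzWith [IsFiniteMeasure P] (hG : LipschitzWith L G)
    {Y : Ω → Model d} (hY : MemLp Y 2 P) : MemLp (fun a => G (Y a)) 2 P := by
  have h : MemLp (fun a => G (Y a) - G 0) 2 P := by
    refine hY.of_le_mul (c := L)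
      ((hG.continuous.comp_aestronglyMeasurable hY.1).sub aestronglyMeasurable_const)
      (Filter.Eventually.of_forall fun a => ?_)
    simpa using hG.norm_sub_le (Y a) 0
  have h2 : MemLp (fun a => G (Y a) - G 0 + G 0) 2 P := h.add (memLp_const (G 0))
  simpa using h2

/-- `g` is an unbiased estimator of the vector field `G`, with variance at most `σ²`, when the
batch is drawn from `D`. -/
structure IsEstimator (G : Model d → Model d) (g : Model d → Ξ → Model d) (D : Measure Ξ)
    (σ : ℝ) : Prop where
  measurable : Measurable (fun q : Model d × Ξ => g q.1 q.2)
  memLp : ∀ x, MemLp (g x) 2 D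
  unbiased : ∀ x, ∫ z, g x z ∂D = G x
  variance_le : ∀ x, ∫ z, ‖g x z - G x‖ ^ 2 ∂D ≤ σ ^ 2

variable [IsProbabilityMeasure P] (hG : LipschitzWith L G) (hg : IsEstimator G g D σ)
  {Y : Ω → Model d} {ζ : Ω → Ξ} (hYm : Measurable Y) (hζ : Measurable ζ) (hlaw : P.map ζ = D)
  (hind : IndepFun Y ζ P)

include hG hg in
theorem IsEstimator.measurable_noise :
    StronglyMeasurable (fun q : Model d × Ξ => g q.1 q.2 - G q.1) :=
  (hg.measurable.sub (hG.continuous.measurable.comp measurable_fst)).stronglyMeasurable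

include hg hζ hlaw in
theorem IsEstimator.memLp_noise_section (x : Model d) :
    MemLp (fun b => g x (ζ b) - G x) 2 P := by
  have h := hg.memLp x
  rw [← hlaw] at h
  exact (h.comp_of_map hζ.aemeasurable).sub (memLp_const _)

include hg hζ hlaw in
theorem IsEstimator.integral_noise_section (x : Model d) :
    ∫ b, (g x (ζ b) - G x) ∂P = 0 := by
  have h := hg.memLp x
  rw [← hlaw] at h
  have hi : Integrable (fun b => g x (ζ b)) P :=
    (h.comp_of_map hζ.aemeasurable).integrable (by norm_num)
  rw [integral_sub hi (integrable_const _), ← integral_map (f := g x) hζ.aemeasurable h.1, hlaw, hg.unbiased]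
  simp

omit [IsProbabilityMeasure P] in
include hg hζ hlaw in
theorem IsEstimator.integral_sq_noise_section (x : Model d) :
    ∫ b, ‖g x (ζ b) - G x‖ ^ 2 ∂P ≤ σ ^ 2 := by
  have h := hg.variance_le x
  rw [← hlaw, integral_map hζ.aemeasurable] at h
  · exact h
  · have h1 := (hg.memLp x).1
    rw [← hlaw] at h1
    exact (h1.sub aestronglyMeasurable_const).norm.pow 2

include hG hg hYm hζ hlaw hind in
theorem IsEstimator.memLp_noise : MemLp (fun a => g (Y a) (ζ a) - G (Y a)) 2 P :=
  memLp_two_comp_of_indepFun hYm hζ hind (hg.measurable_noise hG)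
    (hg.memLp_noise_section hζ hlaw) (q := fun _ => σ ^ 2) measurable_const (integrable_const _)
    (hg.integral_sq_noise_section hζ hlaw)

include hG hg hYm hζ hlaw hind in
theorem IsEstimator.integral_noise : ∫ a, (g (Y a) (ζ a) - G (Y a)) ∂P = 0 := by
  rw [(integral_comp_of_indepFun hYm hζ hind (hg.measurable_noise hG)
    ((hg.memLp_noise hG hYm hζ hlaw hind).integrable (by norm_num))).2]
  simp only [hg.integral_noise_section hζ hlaw, integral_zero]

include hG hg hYm hζ hlaw hind in
theorem IsEstimator.integral_sq_noise_le :
    ∫ a, ‖g (Y a) (ζ a) - G (Y a)‖ ^ 2 ∂P ≤ σ ^ 2 := by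
  have h := integral_comp_of_indepFun hYm hζ hind ((hg.measurable_noise hG).norm.pow 2)
    (integrable_norm_sq_of_memLp_two (hg.memLp_noise hG hYm hζ hlaw hind))
  simp only [Pi.pow_apply] at h
  rw [h.2]
  calc _ ≤ ∫ _, σ ^ 2 ∂P :=
        integral_mono h.1 (integrable_const _) fun a => hg.integral_sq_noise_section hζ hlaw _
    _ = σ ^ 2 := by simp

include hG hg hYm hζ hlaw hind in
-- Given `Y`, the noise has mean zero, so it is orthogonal to every square integrable function of
-- `Y`. This removes the cross term from the variance recursion.
theorem IsEstimator.integral_inner_noise {h : Model d → Model d} (hm : Measurable h)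
    (h2 : MemLp (fun a => h (Y a)) 2 P) :
    ∫ a, inner ℝ (h (Y a)) (g (Y a) (ζ a) - G (Y a)) ∂P = 0 := by
  have hF : StronglyMeasurable
      (fun q : Model d × Ξ => inner ℝ (h q.1) (g q.1 q.2 - G q.1)) :=
    (hm.comp measurable_fst).stronglyMeasurable.inner (hg.measurable_noise hG)
  rw [(integral_comp_of_indepFun hYm hζ hind hF
    (integrable_inner_of_memLp_two h2 (hg.memLp_noise hG hYm hζ hlaw hind))).2]
  have (x : Model d) : ∫ b, inner ℝ (h x) (g x (ζ b) - G x) ∂P = 0 := by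
    rw [integral_inner ((hg.memLp_noise_section hζ hlaw x).integrable (by norm_num)),
      hg.integral_noise_section hζ hlaw, inner_zero_right]
  simp only [this, integral_zero]

/-- The mean of one step of stochastic gradient descent. -/
theorem IsEstimator.integral_step (hG : LipschitzWith L G) (hg : IsEstimator G g D σ)
    (hYm : Measurable Y) (hζ : Measurable ζ) (hlaw : P.map ζ = D) (hind : IndepFun Y ζ P)
    (hY : MemLp Y 2 P) (η : ℝ) :
    MemLp (fun a => Y a - η • g (Y a) (ζ a)) 2 P ∧
    ∫ a, (Y a - η • g (Y a) (ζ a)) ∂P = ∫ a, Y a ∂P - η • ∫ a, G (Y a) ∂P := by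
  have hN := hg.memLp_noise hG hYm hζ hlaw hind
  have hGY := memLp_two_comp_of_lipschitzWith hG hY
  have heq : (fun a => Y a - η • g (Y a) (ζ a)) =
      fun a => (Y a - η • G (Y a)) - η • (g (Y a) (ζ a) - G (Y a)) := by
    funext a
    rw [smul_sub]
    abel
  rw [heq]
  have hz : MemLp (fun a => Y a - η • G (Y a)) 2 P := hY.sub (hGY.const_smul η)
  refine ⟨hz.sub (hN.const_smul η), ?_⟩
  have hi1 : Integrable (fun a => η • (g (Y a) (ζ a) - G (Y a))) P :=
    (hN.integrable (by norm_num)).smul η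
  have hi2 : Integrable (fun a => η • G (Y a)) P := (hGY.integrable (by norm_num)).smul η
  rw [integral_sub (hz.integrable (by norm_num)) hi1, integral_smul,
    hg.integral_noise hG hYm hζ hlaw hind, smul_zero, sub_zero,
    integral_sub (hY.integrable (by norm_num)) hi2, integral_smul]

/-- The variance of one step of stochastic gradient descent. -/
theorem IsEstimator.variance_step (hG : LipschitzWith L G) (hg : IsEstimator G g D σ)
    (hYm : Measurable Y) (hζ : Measurable ζ) (hlaw : P.map ζ = D) (hind : IndepFun Y ζ P)
    (hY : MemLp Y 2 P) {η : ℝ} (hη : 0 ≤ η) :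
    ∫ a, ‖(Y a - η • g (Y a) (ζ a)) - ∫ b, (Y b - η • g (Y b) (ζ b)) ∂P‖ ^ 2 ∂P ≤
      (1 + η * L) ^ 2 * ∫ a, ‖Y a - ∫ b, Y b ∂P‖ ^ 2 ∂P + η ^ 2 * σ ^ 2 := by
  have hN := hg.memLp_noise hG hYm hζ hlaw hind
  have hGY := memLp_two_comp_of_lipschitzWith hG hY
  have hz : MemLp (fun a => Y a - η • G (Y a)) 2 P := hY.sub (hGY.const_smul η)
  have hmean : ∫ b, (Y b - η • g (Y b) (ζ b)) ∂P = ∫ b, (Y b - η • G (Y b)) ∂P := by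
    have hi : Integrable (fun a => η • G (Y a)) P := (hGY.integrable (by norm_num)).smul η
    rw [(hg.integral_step hG hYm hζ hlaw hind hY η).2, integral_sub (hY.integrable (by norm_num))
      hi, integral_smul]
  set e := ∫ b, (Y b - η • G (Y b)) ∂P with he
  set μ := ∫ b, Y b ∂P with hμ
  have hze : MemLp (fun a => Y a - η • G (Y a) - e) 2 P := hz.sub (memLp_const e)
  have hcross := hg.integral_inner_noise hG hYm hζ hlaw hind
    (h := fun y => y - η • G y - e) ((measurable_id.sub
      (hG.continuous.measurable.const_smul η)).sub measurable_const) hze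
  have hexp : ∀ a, ‖(Y a - η • g (Y a) (ζ a)) - e‖ ^ 2 =
      ‖Y a - η • G (Y a) - e‖ ^ 2 +
        (-(2 * η) * inner ℝ (Y a - η • G (Y a) - e) (g (Y a) (ζ a) - G (Y a)) +
        η ^ 2 * ‖g (Y a) (ζ a) - G (Y a)‖ ^ 2) := fun a => by
    have : (Y a - η • g (Y a) (ζ a)) - e =
        (Y a - η • G (Y a) - e) - η • (g (Y a) (ζ a) - G (Y a)) := by
      rw [smul_sub]
      abel
    rw [this, norm_sub_sq_real, inner_smul_right, norm_smul, mul_pow, Real.norm_eq_abs, sq_abs]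
    ring
  have hI1 := integrable_norm_sq_of_memLp_two hze
  have hI2 := (integrable_inner_of_memLp_two hze hN).const_mul (-(2 * η))
  have hI3 := (integrable_norm_sq_of_memLp_two hN).const_mul (η ^ 2)
  rw [hmean]
  simp_rw [hexp]
  rw [integral_add hI1 (by exact hI2.add hI3), integral_add hI2 hI3, integral_const_mul,
    integral_const_mul, hcross, mul_zero, zero_add]
  refine add_le_add ?_ (mul_le_mul_of_nonneg_left
    (hg.integral_sq_noise_le hG hYm hζ hlaw hind) (sq_nonneg η))
  -- The mean minimizes the mean squared distance, so `e` may be replaced by the image of `μ` under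
  -- the deterministic step, which is `(1 + η * L)`-Lipschitz.
  calc ∫ a, ‖Y a - η • G (Y a) - e‖ ^ 2 ∂P
      ≤ ∫ a, ‖Y a - η • G (Y a) - (μ - η • G μ)‖ ^ 2 ∂P :=
        integral_norm_sub_integral_sq_le hz _
    _ ≤ ∫ a, (1 + η * L) ^ 2 * ‖Y a - μ‖ ^ 2 ∂P := by
        refine integral_mono (integrable_norm_sq_of_memLp_two (hz.sub (memLp_const _)))
          ((integrable_norm_sq_of_memLp_two (hY.sub (memLp_const μ))).const_mul _) fun a => ?_
        rw [← mul_pow]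
        refine pow_le_pow_left₀ (norm_nonneg _) ?_ 2
        have : Y a - η • G (Y a) - (μ - η • G μ) = (Y a - μ) - η • (G (Y a) - G μ) := by
          rw [smul_sub]
          abel
        rw [this]
        calc _ ≤ ‖Y a - μ‖ + ‖η • (G (Y a) - G μ)‖ := norm_sub_le _ _
          _ ≤ ‖Y a - μ‖ + η * (L * ‖Y a - μ‖) := by
              rw [norm_smul, Real.norm_of_nonneg hη]
              gcongr
              exact hG.norm_sub_le _ _
          _ = _ := by ring
    _ = _ := integral_const_mul _ _

end StochasticGradient

/-! ### Mean and variance of the local model -/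

section LocalModel

variable {d : ℕ} {Ω Ξ : Type*} [MeasurableSpace Ξ] {g : Model d → Ξ → Model d} {η : ℝ}

/-- The σ-algebra `m` is arbitrary and only batches before step `k` are required, so the lemma also
shows that the local model depends on those batches alone. -/
theorem measurable_localModel {m : MeasurableSpace Ω}
    (hg : Measurable (fun q : Model d × Ξ => g q.1 q.2)) {ξ : ℕ → Ω → Ξ} {X : Ω → Model d}
    (hX : Measurable X) {k : ℕ} (hξ : ∀ j < k, Measurable (ξ j)) :
    Measurable (fun a => localModel g η (fun j => ξ j a) (X a) k) := by
  induction k with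
  | zero => exact hX
  | succ k ih =>
    have h := ih fun j hj => hξ j (Nat.lt_succ_of_lt hj)
    exact h.sub ((hg.comp (h.prodMk (hξ k k.lt_succ_self))).const_smul η)

/-- The assumptions on one client: its batches `ξ k` are independent draws from `D`, and it
estimates a Lipschitz vector field. -/
structure IsClient {mΩ : MeasurableSpace Ω} (P : Measure Ω) (G : Model d → Model d)
    (g : Model d → Ξ → Model d) (D : Measure Ξ) (L : ℝ≥0) (σ : ℝ) (ξ : ℕ → Ω → Ξ) : Prop where
  lipschitz : LipschitzWith L G
  estimator : IsEstimator G g D σ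
  measurable : ∀ k, Measurable (ξ k)
  law : ∀ k, P.map (ξ k) = D
  iIndep : iIndepFun ξ P

variable {mΩ : MeasurableSpace Ω} {P : Measure Ω} [IsProbabilityMeasure P]
  {G : Model d → Model d} {D : Measure Ξ} {L : ℝ≥0} {σ : ℝ} {ξ : ℕ → Ω → Ξ}

omit [IsProbabilityMeasure P] in
theorem IsClient.measurable_localModel (h : IsClient P G g D L σ ξ) (x : Model d) (k : ℕ) :
    Measurable (fun a => localModel g η (fun j => ξ j a) x k) :=
  FedAvg.measurable_localModel h.estimator.measurable measurable_const fun j _ => h.measurable j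

omit [IsProbabilityMeasure P] in
theorem IsClient.indepFun_localModel (h : IsClient P G g D L σ ξ) (x : Model d) (k : ℕ) :
    IndepFun (fun a => localModel g η (fun j => ξ j a) x k) (ξ k) P := by
  refine indepFun_of_measurable_biSup (fun j => (h.measurable j).comap_le) h.iIndep.iIndep
    (A := Set.Iio k) (B := {k}) (by simp) ?_ ?_
  · exact FedAvg.measurable_localModel h.estimator.measurable measurable_const fun j hj =>
      measurable_biSup_of_comap_le (Set.mem_Iio.2 hj) le_rfl
  · exact measurable_biSup_of_comap_le (Set.mem_singleton k) le_rfl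

theorem IsClient.memLp_localModel (h : IsClient P G g D L σ ξ) (x : Model d) (k : ℕ) :
    MemLp (fun a => localModel g η (fun j => ξ j a) x k) 2 P := by
  induction k with
  | zero => exact memLp_const x
  | succ k ih =>
    exact (h.estimator.integral_step h.lipschitz (h.measurable_localModel x k) (h.measurable k)
      (h.law k) (h.indepFun_localModel x k) ih η).1

/-- The mean of the local model after `k` steps. -/
noncomputable def localMean (P : Measure Ω) (g : Model d → Ξ → Model d) (η : ℝ) (ξ : ℕ → Ω → Ξ)
    (x : Model d) (k : ℕ) : Model d :=
  ∫ a, localModel g η (fun j => ξ j a) x k ∂P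

/-- The variance of the local model after `k` steps. -/
noncomputable def localVar (P : Measure Ω) (g : Model d → Ξ → Model d) (η : ℝ) (ξ : ℕ → Ω → Ξ)
    (x : Model d) (k : ℕ) : ℝ :=
  ∫ a, ‖localModel g η (fun j => ξ j a) x k - localMean P g η ξ x k‖ ^ 2 ∂P

theorem IsClient.localMean_succ (h : IsClient P G g D L σ ξ) (x : Model d) (k : ℕ) :
    localMean P g η ξ x (k + 1) = localMean P g η ξ x k -
      η • ∫ a, G (localModel g η (fun j => ξ j a) x k) ∂P :=
  (h.estimator.integral_step h.lipschitz (h.measurable_localModel x k) (h.measurable k)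
      (h.law k) (h.indepFun_localModel x k) (h.memLp_localModel x k) η).2

theorem IsClient.localVar_succ_le (h : IsClient P G g D L σ ξ) (hη : 0 ≤ η) (x : Model d)
    (k : ℕ) : localVar P g η ξ x (k + 1) ≤
      (1 + η * L) ^ 2 * localVar P g η ξ x k + η ^ 2 * σ ^ 2 :=
  h.estimator.variance_step h.lipschitz (h.measurable_localModel x k) (h.measurable k)
      (h.law k) (h.indepFun_localModel x k) (h.memLp_localModel x k) hη

omit [MeasurableSpace Ξ] in
theorem localMean_zero (x : Model d) : localMean P g η ξ x 0 = x := by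
  simp [localMean, localModel]

omit [MeasurableSpace Ξ] in
theorem localVar_zero (x : Model d) : localVar P g η ξ x 0 = 0 := by
  simp [localVar, localModel, localMean_zero]

omit [MeasurableSpace Ξ] [IsProbabilityMeasure P] in
theorem localVar_nonneg (x : Model d) (k : ℕ) : 0 ≤ localVar P g η ξ x k :=
  integral_nonneg fun _ => by positivity

/-- The mean drift of the gradient along a local trajectory. -/
theorem IsClient.norm_integral_sub_le (h : IsClient P G g D L σ ξ) (x : Model d) (k : ℕ) :
    ‖(∫ a, G (localModel g η (fun j => ξ j a) x k) ∂P) - G x‖ ≤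
      L * √(localVar P g η ξ x k + ‖localMean P g η ξ x k - x‖ ^ 2) := by
  have hY := h.memLp_localModel (η := η) x k
  have hYx : MemLp (fun a => localModel g η (fun j => ξ j a) x k - x) 2 P :=
    hY.sub (memLp_const x)
  have hGY := memLp_two_comp_of_lipschitzWith h.lipschitz hY
  have h1 : (∫ a, G (localModel g η (fun j => ξ j a) x k) ∂P) - G x =
      ∫ a, (G (localModel g η (fun j => ξ j a) x k) - G x) ∂P := by
    rw [integral_sub (hGY.integrable (by norm_num)) (integrable_const _)]
    simp
  rw [h1]
  calc _ ≤ ∫ a, L * ‖localModel g η (fun j => ξ j a) x k - x‖ ∂P :=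
        norm_integral_le_of_norm_le ((hYx.integrable (by norm_num)).norm.const_mul _)
          (Filter.Eventually.of_forall fun a => h.lipschitz.norm_sub_le _ _)
    _ = L * ∫ a, ‖localModel g η (fun j => ξ j a) x k - x‖ ∂P := integral_const_mul _ _
    _ ≤ _ := by
        refine mul_le_mul_of_nonneg_left (Real.le_sqrt_of_sq_le ?_) L.2
        refine (sq_integral_norm_le hYx).trans (le_of_eq ?_)
        exact integral_norm_sub_sq hY x

end LocalModel

/-! ### Discrete Grönwall bounds -/

section Recursions

theorem le_mul_pow_of_succ_le {V : ℕ → ℝ} {r A : ℝ} (hr : 1 ≤ r) (hA : 0 ≤ A) (h0 : V 0 = 0)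
    (h : ∀ k, V (k + 1) ≤ r * V k + A) (k : ℕ) : V k ≤ k * A * r ^ k := by
  induction k with
  | zero => simp [h0]
  | succ k ih =>
    have h1 : 1 ≤ r ^ (k + 1) := one_le_pow₀ hr
    calc V (k + 1) ≤ r * (k * A * r ^ k) + A * 1 := by
          have := mul_le_mul_of_nonneg_left ih (zero_le_one.trans hr)
          linarith [h k]
      _ ≤ r * (k * A * r ^ k) + A * r ^ (k + 1) := by gcongr
      _ = (k + 1 : ℕ) * A * r ^ (k + 1) := by push_cast; ring

theorem one_add_sq_pow_le_three {e : ℝ} {k : ℕ} (he : 0 ≤ e) (hk : e * k ≤ 9 / 20) :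
    ((1 + e) ^ 2) ^ k ≤ 3 := by
  calc ((1 + e) ^ 2) ^ k ≤ ((Real.exp e) ^ 2) ^ k := by
        gcongr
        linarith [Real.add_one_le_exp e]
    _ = Real.exp (2 * (e * k)) := by
        rw [← pow_mul, ← Real.exp_nat_mul]
        push_cast
        ring_nf
    _ ≤ Real.exp 1 := Real.exp_le_exp.2 (by linarith)
    _ ≤ 3 := by linarith [Real.exp_one_lt_d9]

/-- The exact solution `((1 + e) ^ k - 1) / e * B` starts with `(k + e * k * (k - 1) / 2) * B`. A
quadratic coefficient `2 / 3` absorbs the higher orders as long as `e * k ≤ 9 / 20`, and `1 + 2 / 3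
* 9 / 20 = 13 / 10`. -/
theorem le_of_succ_le_one_add_mul {b : ℕ → ℝ} {e B : ℝ} {K : ℕ} (he : 0 ≤ e) (hB : 0 ≤ B)
    (hK : e * K ≤ 9 / 20) (h0 : b 0 = 0) (h : ∀ k < K, b (k + 1) ≤ (1 + e) * b k + B) {k : ℕ}
    (hk : k ≤ K) : b k ≤ 13 / 10 * k * B := by
  have hek : ∀ j ≤ K, e * j ≤ 9 / 20 := fun j hj =>
    (mul_le_mul_of_nonneg_left (Nat.cast_le.2 hj) he).trans hK
  have key : ∀ j ≤ K, b j ≤ (j + 2 / 3 * e * j ^ 2) * B := by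
    intro j
    induction j with
    | zero => simp [h0]
    | succ j ih =>
      intro hj
      have h1 := ih (by omega)
      have h2 := hek j (by omega)
      have h3 : (1 + e) * (j + 2 / 3 * e * j ^ 2) + 1 ≤
          ((j : ℝ) + 1) + 2 / 3 * e * (j + 1) ^ 2 := by
        have : e * j * (e * j) ≤ 9 / 20 * (e * j) :=
          mul_le_mul_of_nonneg_right h2 (by positivity)
        have : 0 ≤ e * j := by positivity
        nlinarith
      calc b (j + 1) ≤ (1 + e) * ((j + 2 / 3 * e * j ^ 2) * B) + B := by
            have := mul_le_mul_of_nonneg_left h1 (by linarith : 0 ≤ 1 + e)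
            linarith [h j (by omega)]
        _ = ((1 + e) * (j + 2 / 3 * e * j ^ 2) + 1) * B := by ring
        _ ≤ _ := by
            push_cast
            exact mul_le_mul_of_nonneg_right h3 hB
  refine (key k hk).trans (mul_le_mul_of_nonneg_right ?_ hB)
  have : e * k * k ≤ 9 / 20 * k := mul_le_mul_of_nonneg_right (hek k hk) (by positivity)
  nlinarith

theorem sum_range_natCast (K : ℕ) : ∑ k ∈ Finset.range K, (k : ℝ) = K * ((K : ℝ) - 1) / 2 := by
  induction K with
  | zero => simp
  | succ K ih => rw [Finset.sum_range_succ, ih]; push_cast; ring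

theorem sum_range_natCast_sq_le (K : ℕ) :
    ∑ k ∈ Finset.range K, (k : ℝ) ^ 2 ≤ K ^ 2 * ((K : ℝ) - 1) / 3 := by
  induction K with
  | zero => simp
  | succ K ih =>
    rw [Finset.sum_range_succ]
    push_cast
    nlinarith [(Nat.cast_nonneg K : (0 : ℝ) ≤ K)]

end Recursions

/-! ### Drift of a single client -/

section ClientDrift

variable {d : ℕ} {Ω Ξ : Type*} [MeasurableSpace Ξ] {g : Model d → Ξ → Model d} {η : ℝ}
  {mΩ : MeasurableSpace Ω} {P : Measure Ω} [IsProbabilityMeasure P]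
  {G : Model d → Model d} {D : Measure Ξ} {L : ℝ≥0} {σ : ℝ} {ξ : ℕ → Ω → Ξ}

theorem IsClient.localVar_le (h : IsClient P G g D L σ ξ) (hη : 0 ≤ η) {k : ℕ}
    (hk : η * L * k ≤ 9 / 20) (x : Model d) :
    localVar P g η ξ x k ≤ 3 * k * (η ^ 2 * σ ^ 2) := by
  have hL : 0 ≤ η * L := mul_nonneg hη L.2
  refine (le_mul_pow_of_succ_le (r := (1 + η * L) ^ 2) (one_le_pow₀ (by linarith))
    (by positivity) (localVar_zero x) (h.localVar_succ_le hη x) k).trans ?_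
  have := mul_le_mul_of_nonneg_left (one_add_sq_pow_le_three hL hk)
    (by positivity : 0 ≤ k * (η ^ 2 * σ ^ 2))
  linarith

/-- The squared drift of the mean of the local model. -/
theorem IsClient.sq_norm_localMean_sub_le (h : IsClient P G g D L σ ξ) (hη : 0 ≤ η) {K : ℕ}
    (hK : η * L * K ≤ 9 / 20) (hK1 : 1 ≤ K) (x : Model d) {k : ℕ} (hk : k ≤ K) :
    ‖localMean P g η ξ x k - x‖ ^ 2 ≤ (k : ℝ) ^ 2 *
      (η ^ 2 * (17 / 8 * ‖G x‖ ^ 2 + 26 * L ^ 2 * ((K : ℝ) - 1) * (η ^ 2 * σ ^ 2))) := by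
  have hL : 0 ≤ η * L := mul_nonneg hη L.2
  have hK1' : (0 : ℝ) ≤ (K : ℝ) - 1 := by
    have : (1 : ℝ) ≤ K := by exact_mod_cast hK1
    linarith
  -- Bounds the variance at every step `j < K`. Gradients are evaluated only at these steps, hence
  -- `K - 1` instead of `K`.
  set q : ℝ := 3 * ((K : ℝ) - 1) * (η ^ 2 * σ ^ 2) with hq
  have hq0 : 0 ≤ q := by positivity
  set B := η * (‖G x‖ + L * √q) with hB
  have hB0 : 0 ≤ B := mul_nonneg hη (add_nonneg (norm_nonneg _) (mul_nonneg L.2 (by positivity)))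
  have hb := le_of_succ_le_one_add_mul (b := fun k => ‖localMean P g η ξ x k - x‖) (e := η * L)
    (B := B) (K := K) hL hB0 hK (by simp [localMean_zero]) (fun j hj => by
      have hV : localVar P g η ξ x j ≤ q := by
        have hjK : η * L * j ≤ 9 / 20 :=
          (mul_le_mul_of_nonneg_left (Nat.cast_le.2 hj.le) hL).trans hK
        refine (h.localVar_le hη hjK x).trans ?_
        have : (j : ℝ) ≤ (K : ℝ) - 1 := by
          have : ((j + 1 : ℕ) : ℝ) ≤ K := Nat.cast_le.2 hj
          push_cast at this
          linarith
        rw [hq]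
        gcongr
      set u := localMean P g η ξ x j - x with hu
      set w := (∫ a, G (localModel g η (fun i => ξ i a) x j) ∂P) - G x with hw
      have h1 : localMean P g η ξ x (j + 1) - x = u - η • (w + G x) := by
        rw [h.localMean_succ, hu, hw, sub_add_cancel]
        abel
      have h2 : ‖w‖ ≤ L * (√q + ‖u‖) := by
        refine (h.norm_integral_sub_le x j).trans (mul_le_mul_of_nonneg_left ?_ L.2)
        refine Real.sqrt_le_iff.2 ⟨by positivity, ?_⟩
        have h3 := Real.sq_sqrt hq0
        nlinarith [mul_nonneg (Real.sqrt_nonneg q) (norm_nonneg u)]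
      show ‖localMean P g η ξ x (j + 1) - x‖ ≤ (1 + η * L) * ‖u‖ + B
      rw [h1]
      calc ‖u - η • (w + G x)‖ ≤ ‖u‖ + η * (‖w‖ + ‖G x‖) := by
            refine (norm_sub_le _ _).trans ?_
            rw [norm_smul, Real.norm_of_nonneg hη]
            gcongr
            exact norm_add_le _ _
        _ ≤ ‖u‖ + η * (L * (√q + ‖u‖) + ‖G x‖) := by gcongr
        _ = _ := by rw [hB]; ring) hk
  calc ‖localMean P g η ξ x k - x‖ ^ 2 ≤ (13 / 10 * k * B) ^ 2 :=
        pow_le_pow_left₀ (norm_nonneg _) hb 2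
    _ = (k : ℝ) ^ 2 * (η ^ 2 * (169 / 100 * (‖G x‖ + L * √q) ^ 2)) := by rw [hB]; ring
    _ ≤ _ := by
        gcongr
        have h3 := Real.sq_sqrt hq0
        have h4 : (L * √q) ^ 2 = 3 * L ^ 2 * ((K : ℝ) - 1) * (η ^ 2 * σ ^ 2) := by
          rw [mul_pow, h3, hq]
          ring
        have h5 : 0 ≤ ‖G x‖ ^ 2 := by positivity
        have h6 : 0 ≤ (L * √q) ^ 2 := by positivity
        -- This square gives `(a + b)² ≤ 5/4 a² + 5 b²`; multiplied by `169/100` the coefficients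
        -- stay below `17/8` and `26/3`, and `b²` carries a factor `3`.
        nlinarith [sq_nonneg (‖G x‖ / 2 - 2 * (L * √q))]

/-- The mean of the local progress is close to `K` steps of gradient descent at the start. -/
theorem IsClient.sq_norm_localMean_sub_add_le (h : IsClient P G g D L σ ξ) (hη : 0 ≤ η) {K : ℕ}
    (hK : η * L * K ≤ 9 / 20) (hK1 : 1 ≤ K) (x : Model d) :
    ‖localMean P g η ξ x K - x + (η * K) • G x‖ ^ 2 ≤ η ^ 2 * L ^ 2 * K *
      (3 / 2 * (K * ((K : ℝ) - 1)) * (η ^ 2 * σ ^ 2) + K ^ 2 * ((K : ℝ) - 1) / 3 *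
      (η ^ 2 * (17 / 8 * ‖G x‖ ^ 2 + 26 * L ^ 2 * ((K : ℝ) - 1) * (η ^ 2 * σ ^ 2)))) := by
  have hL : 0 ≤ η * L := mul_nonneg hη L.2
  have hK1' : (0 : ℝ) ≤ (K : ℝ) - 1 := by
    have : (1 : ℝ) ≤ K := by exact_mod_cast hK1
    linarith
  set w : ℕ → Model d := fun k => (∫ a, G (localModel g η (fun i => ξ i a) x k) ∂P) - G x with hw
  -- The deviation from `k` exact gradient steps is the accumulated drift of the averaged gradients.
  have hsum : ∀ k : ℕ, localMean P g η ξ x k - x + (η * k) • G x =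
      -η • ∑ j ∈ Finset.range k, w j := by
    intro k
    induction k with
    | zero => simp [localMean_zero]
    | succ k ih =>
      rw [Finset.sum_range_succ, smul_add, ← ih, h.localMean_succ, hw]
      simp only [smul_sub, neg_smul]
      push_cast
      rw [mul_add, add_smul, mul_one]
      abel
  set A := η ^ 2 * (17 / 8 * ‖G x‖ ^ 2 + 26 * L ^ 2 * ((K : ℝ) - 1) * (η ^ 2 * σ ^ 2)) with hA
  have hA0 : 0 ≤ A := by positivity
  have hwk : ∀ k ∈ Finset.range K, ‖w k‖ ^ 2 ≤
      L ^ 2 * (3 * (η ^ 2 * σ ^ 2) * k + A * k ^ 2) := by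
    intro k hk
    have hkK := Finset.mem_range.1 hk
    have hjK : η * L * k ≤ 9 / 20 :=
      (mul_le_mul_of_nonneg_left (Nat.cast_le.2 hkK.le) hL).trans hK
    have h0 : 0 ≤ localVar P g η ξ x k + ‖localMean P g η ξ x k - x‖ ^ 2 :=
      add_nonneg (localVar_nonneg x k) (by positivity)
    calc ‖w k‖ ^ 2 ≤ (L * √(localVar P g η ξ x k + ‖localMean P g η ξ x k - x‖ ^ 2)) ^ 2 :=
          pow_le_pow_left₀ (norm_nonneg _) (h.norm_integral_sub_le x k) 2
      _ = L ^ 2 * (localVar P g η ξ x k + ‖localMean P g η ξ x k - x‖ ^ 2) := by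
          rw [mul_pow, Real.sq_sqrt h0]
      _ ≤ _ := by
          gcongr
          · exact (h.localVar_le hη hjK x).trans (le_of_eq (by ring))
          · exact (h.sq_norm_localMean_sub_le hη hK hK1 x hkK.le).trans (le_of_eq (by ring))
  rw [hsum K, norm_smul, mul_pow, norm_neg, Real.norm_eq_abs, sq_abs]
  calc η ^ 2 * ‖∑ j ∈ Finset.range K, w j‖ ^ 2
      ≤ η ^ 2 * (K * ∑ j ∈ Finset.range K, ‖w j‖ ^ 2) := by
        gcongr
        calc _ ≤ (∑ j ∈ Finset.range K, ‖w j‖) ^ 2 :=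
              pow_le_pow_left₀ (norm_nonneg _) (norm_sum_le _ _) 2
          _ ≤ _ := by simpa using sq_sum_le_card_mul_sum_sq (s := Finset.range K)
                        (f := fun j => ‖w j‖)
    _ ≤ η ^ 2 * (K * ∑ k ∈ Finset.range K, L ^ 2 * (3 * (η ^ 2 * σ ^ 2) * k + A * k ^ 2)) := by
        gcongr with k hk
        exact hwk k hk
    _ = η ^ 2 * L ^ 2 * K * (3 * (η ^ 2 * σ ^ 2) * ∑ k ∈ Finset.range K, (k : ℝ) +
          A * ∑ k ∈ Finset.range K, (k : ℝ) ^ 2) := by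
        rw [← Finset.mul_sum, Finset.sum_add_distrib, ← Finset.mul_sum, ← Finset.mul_sum]
        ring
    _ ≤ η ^ 2 * L ^ 2 * K * (3 * (η ^ 2 * σ ^ 2) * (K * ((K : ℝ) - 1) / 2) +
          A * (K ^ 2 * ((K : ℝ) - 1) / 3)) := by
        rw [sum_range_natCast]
        gcongr
        exact sum_range_natCast_sq_le K
    _ = _ := by ring

end ClientDrift

/-! ### Second moment of the aggregate -/

section Aggregation

variable {n : ℕ} {Ω E : Type*} {mΩ : MeasurableSpace Ω} {P : Measure Ω}
  [NormedAddCommGroup E] [InnerProductSpace ℝ E] [MeasurableSpace E] [BorelSpace E]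

theorem memLp_two_smul_of_indepFun {X : Ω → ℝ} {Y : Ω → E} (hX : MemLp X 2 P) (hY : MemLp Y 2 P)
    (h : IndepFun X Y P) : MemLp (fun a => X a • Y a) 2 P := by
  refine (memLp_two_iff_integrable_sq_norm (hX.1.smul hY.1)).2 ?_
  have h1 : IndepFun (fun a => ‖X a‖ ^ 2) (fun a => ‖Y a‖ ^ 2) P :=
    h.comp (φ := fun x : ℝ => ‖x‖ ^ 2) (ψ := fun y : E => ‖y‖ ^ 2)
      (by fun_prop) (by fun_prop)
  refine (h1.integrable_mul (integrable_norm_sq_of_memLp_two hX)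
    (integrable_norm_sq_of_memLp_two hY)).congr (Filter.Eventually.of_forall fun a => ?_)
  simp [norm_smul, mul_pow]

variable [IsProbabilityMeasure P] [CompleteSpace E] [SecondCountableTopology E]

theorem integral_inner_of_indepFun {X Y : Ω → E} (hXm : Measurable X) (hYm : Measurable Y)
    (hX : MemLp X 2 P) (hY : MemLp Y 2 P) (h : IndepFun X Y P) :
    ∫ a, inner ℝ (X a) (Y a) ∂P = inner ℝ (∫ a, X a ∂P) (∫ a, Y a ∂P) := by
  rw [(integral_comp_of_indepFun hXm hYm h (F := fun q : E × E => inner ℝ q.1 q.2)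
    (by fun_prop) (integrable_inner_of_memLp_two hX hY)).2]
  simp_rw [integral_inner (hY.integrable (by norm_num : (1 : ENNReal) ≤ 2))]
  simp_rw [real_inner_comm (∫ a, Y a ∂P)]
  rw [integral_inner (hX.integrable (by norm_num))]

variable {W : Fin n → Ω → ℝ} {Δ : Fin n → Ω → E}

/-- The second moment of the aggregate of independent contributions, for aggregation weights with
covariances `-α p_i p_j`. -/
theorem integral_norm_sq_aggregate (hW : ∀ i, MemLp (W i) 2 P)
    (hΔm : ∀ i, Measurable (Δ i)) (hΔ : ∀ i, MemLp (Δ i) 2 P)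
    (hΔΔ : ∀ i j, i ≠ j → IndepFun (Δ i) (Δ j) P)
    (hWΔ : IndepFun (fun a i => W i a) (fun a i => Δ i a) P) {p v : Fin n → ℝ} {α : ℝ}
    (hW1 : ∀ i, ∫ a, W i a ∂P = p i)
    (hW2 : ∀ i j, ∫ a, W i a * W j a ∂P =
      (1 - α) * (p i * p j) + if i = j then v i + α * p i ^ 2 else 0) :
    MemLp (fun a => ∑ i, W i a • Δ i a) 2 P ∧
    ∫ a, ∑ i, W i a • Δ i a ∂P = ∑ i, p i • ∫ a, Δ i a ∂P ∧
    ∫ a, ‖∑ i, W i a • Δ i a‖ ^ 2 ∂P =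
      (1 - α) * ‖∑ i, p i • ∫ a, Δ i a ∂P‖ ^ 2 +
      (∑ i, (v i + p i ^ 2) * ∫ a, ‖Δ i a - ∫ b, Δ i b ∂P‖ ^ 2 ∂P) +
      ∑ i, (v i + α * p i ^ 2) * ‖∫ a, Δ i a ∂P‖ ^ 2 := by
  have hind : ∀ i, IndepFun (W i) (Δ i) P := fun i =>
    hWΔ.comp (measurable_pi_apply i) (measurable_pi_apply i)
  have hT : ∀ i, MemLp (fun a => W i a • Δ i a) 2 P := fun i =>
    memLp_two_smul_of_indepFun (hW i) (hΔ i) (hind i)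
  refine ⟨memLp_finsetSum _ fun i _ => hT i, ?_, ?_⟩
  · rw [integral_finsetSum _ fun i _ => (hT i).integrable (by norm_num)]
    refine Finset.sum_congr rfl fun i _ => ?_
    rw [← hW1 i]
    exact (hind i).integral_smul_eq_smul_integral (hW i).1 (hΔ i).1
  set m : Fin n → E := fun i => ∫ a, Δ i a ∂P with hm
  set V : Fin n → ℝ := fun i => ∫ a, ‖Δ i a - m i‖ ^ 2 ∂P with hV
  have hin : ∀ i j, ∫ a, inner ℝ (Δ i a) (Δ j a) ∂P =
      inner ℝ (m i) (m j) + if i = j then V i else 0 := by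
    intro i j
    split_ifs with hij
    · subst hij
      have := integral_norm_sub_sq (hΔ i) 0
      simp only [sub_zero] at this
      simp only [real_inner_self_eq_norm_sq, this, hV, hm]
      ring
    · rw [integral_inner_of_indepFun (hΔm i) (hΔm j) (hΔ i) (hΔ j) (hΔΔ i j hij), add_zero]
  have hWin : ∀ i j, ∫ a, inner ℝ (W i a • Δ i a) (W j a • Δ j a) ∂P =
      ((1 - α) * (p i * p j) + if i = j then v i + α * p i ^ 2 else 0) *
        (inner ℝ (m i) (m j) + if i = j then V i else 0) := by
    intro i j
    have h1 : IndepFun (fun a => W i a * W j a) (fun a => inner ℝ (Δ i a) (Δ j a)) P :=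
      hWΔ.comp (φ := fun w : Fin n → ℝ => w i * w j)
        (ψ := fun y : Fin n → E => inner ℝ (y i) (y j)) (by fun_prop) (by fun_prop)
    rw [← hW2, ← hin, ← h1.integral_fun_mul_eq_mul_integral ((hW i).1.mul (hW j).1)
      ((hΔ i).1.inner (hΔ j).1)]
    refine integral_congr_ae (Filter.Eventually.of_forall fun a => ?_)
    simp only [real_inner_smul_left, real_inner_smul_right]
    ring
  have hsq : ∀ a, ‖∑ i, W i a • Δ i a‖ ^ 2 =
      ∑ i, ∑ j, inner ℝ (W i a • Δ i a) (W j a • Δ j a) := fun a => by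
    rw [← real_inner_self_eq_norm_sq, sum_inner]
    simp_rw [inner_sum]
  have hint : ∀ i j, Integrable (fun a => inner ℝ (W i a • Δ i a) (W j a • Δ j a)) P :=
    fun i j => integrable_inner_of_memLp_two (hT i) (hT j)
  have hM : ‖∑ i, p i • m i‖ ^ 2 = ∑ i, ∑ j, p i * p j * inner ℝ (m i) (m j) := by
    rw [← real_inner_self_eq_norm_sq, sum_inner]
    simp_rw [inner_sum, real_inner_smul_left, real_inner_smul_right, mul_assoc]
  simp_rw [hsq]
  rw [integral_finsetSum _ fun i _ => integrable_finsetSum _ fun j _ => hint i j]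
  simp_rw [integral_finsetSum _ fun j (_ : j ∈ Finset.univ) => hint _ j, hWin]
  rw [hM, Finset.mul_sum, ← Finset.sum_add_distrib, ← Finset.sum_add_distrib]
  refine Finset.sum_congr rfl fun i _ => ?_
  -- Both second-moment matrices are a rank-one or Gram part plus a diagonal. On the diagonal the
  -- weight moment is `v i + p i ^ 2`, where `α` cancels; this is the coefficient of the noise.
  have hterm : ∀ j, ((1 - α) * (p i * p j) + if i = j then v i + α * p i ^ 2 else 0) *
      (inner ℝ (m i) (m j) + if i = j then V i else 0) =
      (1 - α) * (p i * p j * inner ℝ (m i) (m j)) +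
        if i = j then (v i + p i ^ 2) * V i + (v i + α * p i ^ 2) * ‖m i‖ ^ 2 else 0 := by
    intro j
    split_ifs with hij
    · subst hij
      rw [real_inner_self_eq_norm_sq]
      ring
    · ring
  simp_rw [hterm]
  rw [Finset.sum_add_distrib, ← Finset.mul_sum, Finset.sum_ite_eq]
  simp only [Finset.mem_univ, if_true, hV, hm, add_assoc]

end Aggregation

/-! ### Choice of constants in one round -/

section Arithmetic

/-- The arithmetic of one round. -/
theorem round_arithmetic {ηg η L K b N k₂ s Γ W X V M : ℝ} (hηg : 0 < ηg) (hη : 0 < η)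
    (hL : 0 ≤ L) (hK : 1 ≤ K) (hb : 1 ≤ b) (hN : 0 ≤ N) (hk : 0 ≤ k₂) (hs : 0 ≤ s) (hΓ : 0 ≤ Γ)
    (hW : 0 ≤ W) (h1 : 2 * (2 * b + 1) * η ^ 2 * L ^ 2 * K ^ 2 < 1)
    (h3 : 3 * L * ηg * η * K * Γ * b ≤ 1)
    (hX : X ≤ η ^ 2 * L ^ 2 * K * (3 / 2 * (K * (K - 1)) * (η ^ 2 * s) + K ^ 2 * (K - 1) / 3 *
      (η ^ 2 * (17 / 8 * (b * N + k₂) + 26 * L ^ 2 * (K - 1) * (η ^ 2 * s)))))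
    (hV : V ≤ W * (3 * K * (η ^ 2 * s)))
    (hM : M ≤ K ^ 2 * (η ^ 2 * (17 / 8 * (b * N + k₂) + 26 * L ^ 2 * (K - 1) * (η ^ 2 * s))) * Γ) :
    ηg / (2 * (η * K)) * X - ηg * (η * K) / 2 * N + L / 2 * ηg ^ 2 * (V + M) ≤
      -(1 / 20) * (ηg * η * K) * N + 3 * (ηg * η * K) * (L * (ηg * η * W * s) +
        L ^ 2 * (η ^ 2 * (K - 1) * s) + L ^ 2 * (η ^ 2 * K * (K - 1) * k₂) +
        L * (ηg * η * Γ * ((K - 1) * s + K * k₂))) := by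
  have hK0 : 0 < K := by linarith
  have hK1 : 0 ≤ K - 1 := by linarith
  set u := η ^ 2 * L ^ 2 * K ^ 2 with hu
  have hu0 : 0 ≤ u := by positivity
  -- The hypothesis `h1` reads `4 * u * b + 2 * u < 1`; with `b ≥ 1` it also gives `u ≤ 1 / 6`.
  have hub : u * b ≤ 1 / 4 := by nlinarith
  have hu6 : u ≤ 1 / 6 := by nlinarith
  set Q := L ^ 2 * (η ^ 2 * K * (K - 1)) with hQ
  have hQ0 : 0 ≤ Q := by positivity
  have hQu : Q ≤ u := by
    have : u - Q = L ^ 2 * η ^ 2 * K := by rw [hu, hQ]; ring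
    have : 0 ≤ L ^ 2 * η ^ 2 * K := by positivity
    linarith
  have hRu : L ^ 2 * η ^ 2 * K ≤ u := by
    have : u - L ^ 2 * η ^ 2 * K = Q := by rw [hu, hQ]; ring
    linarith
  set a := ηg * η * K with ha
  have ha0 : 0 ≤ a := by positivity
  set Y := L * ηg * η * K * Γ with hY
  have hYb : Y * b ≤ 1 / 3 := by rw [hY]; linarith
  set Z := L ^ 2 * (η ^ 2 * (K - 1) * s) with hZ
  have hZ0 : 0 ≤ Z := by positivity
  set H := L * (ηg * η * Γ * ((K - 1) * s)) with hH
  have hH0 : 0 ≤ H := by positivity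
  have e1 : ηg / (2 * (η * K)) * X ≤
      a * (3 / 4 * Z + 17 / 48 * (Q * b * N + Q * k₂) + 13 / 3 * Q * Z) := by
    refine (mul_le_mul_of_nonneg_left hX (by positivity)).trans (le_of_eq ?_)
    rw [ha, hZ, hQ]
    field_simp
    ring
  have e2 : L / 2 * ηg ^ 2 * V ≤ a * (3 / 2 * (L * (ηg * η * W * s))) := by
    refine (mul_le_mul_of_nonneg_left hV (by positivity)).trans (le_of_eq ?_)
    rw [ha]
    ring
  have e3 : L / 2 * ηg ^ 2 * M ≤
      a * (17 / 16 * (Y * b * N + Y * k₂) + 13 * (L ^ 2 * η ^ 2 * K) * H) := by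
    refine (mul_le_mul_of_nonneg_left hM (by positivity)).trans (le_of_eq ?_)
    rw [ha, hY, hH]
    ring
  have f1 : Q * b * N ≤ 1 / 4 * N :=
    mul_le_mul_of_nonneg_right ((mul_le_mul_of_nonneg_right hQu (by linarith)).trans hub) hN
  have f2 : Q * Z ≤ 1 / 6 * Z := mul_le_mul_of_nonneg_right (hQu.trans hu6) hZ0
  have f3 : Y * b * N ≤ 1 / 3 * N := mul_le_mul_of_nonneg_right hYb hN
  have f4 : (L ^ 2 * η ^ 2 * K) * H ≤ 1 / 6 * H :=
    mul_le_mul_of_nonneg_right (hRu.trans hu6) hH0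
  have g0 : 0 ≤ L * (ηg * η * W * s) := by positivity
  have g1 : 0 ≤ Q * k₂ := by positivity
  have g2 : 0 ≤ Y * k₂ := by positivity
  -- The coefficient of `N` is `17/48 * 1/4 + 17/16 * 1/3 = 85/192 < 9/20`, which leaves `1/20` of
  -- the initial `1/2`; all error coefficients are below `3`.
  have hsum : (3 / 4 * Z + 17 / 48 * (Q * b * N + Q * k₂) + 13 / 3 * Q * Z) +
      3 / 2 * (L * (ηg * η * W * s)) +
      (17 / 16 * (Y * b * N + Y * k₂) + 13 * (L ^ 2 * η ^ 2 * K) * H) ≤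
      9 / 20 * N + 3 * (L * (ηg * η * W * s) + Z + Q * k₂ + (H + Y * k₂)) := by linarith
  have hfin := mul_le_mul_of_nonneg_left hsum ha0
  have r1 : L ^ 2 * (η ^ 2 * K * (K - 1) * k₂) = Q * k₂ := by rw [hQ]; ring
  have r2 : L * (ηg * η * Γ * ((K - 1) * s + K * k₂)) = H + Y * k₂ := by rw [hH, hY]; ring
  rw [r1, r2]
  have r3 : ηg * (η * K) = a := by rw [ha]; ring
  rw [r3]
  linarith

end Arithmetic

/-! ### Dissimilarity for unnormalized weights -/

section Dissimilarity

/-- Normalizing `w` gives a point of the simplex unless all weights vanish. It is needed for the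
weights `γ_i`, and is the reason why the dissimilarity bound is assumed for all convex combinations.
-/
theorem sum_mul_sq_norm_gradient_le {n d : ℕ} {p : Fin n → ℝ} {loss : Fin n → Model d → ℝ}
    {β κ : ℝ} (h : BoundedDissimilarity p loss β κ) {w : Fin n → ℝ} (hw : ∀ i, 0 ≤ w i)
    (x : Model d) : ∑ i, w i * ‖∇ (loss i) x‖ ^ 2 ≤
      (β ^ 2 * ‖∇ (fedLoss p loss) x‖ ^ 2 + κ ^ 2) * ∑ i, w i := by
  rcases (Finset.sum_nonneg fun i _ => hw i : 0 ≤ ∑ i, w i).eq_or_lt with h0 | h0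
  · have hz : ∀ i, w i = 0 := fun i =>
      (Finset.sum_eq_zero_iff_of_nonneg fun i _ => hw i).1 h0.symm i (Finset.mem_univ i)
    simp [hz]
  · have hb := h.bound (fun i => w i / ∑ j, w j)
      ⟨fun i => div_nonneg (hw i) h0.le, by rw [← Finset.sum_div, div_self h0.ne']⟩ x
    rw [← div_le_iff₀ h0, Finset.sum_div]
    refine le_trans (le_of_eq (Finset.sum_congr rfl fun i _ => ?_)) hb
    ring

end Dissimilarity

/-! ### Measurability of a round -/

section RoundMeasurability

variable {n d : ℕ} {Ω 𝒮 Ξ : Type*} [MeasurableSpace 𝒮] [MeasurableSpace Ξ]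
  {wt : 𝒮 → Fin n → ℝ} {g : Fin n → Model d → Ξ → Model d} {ηg ηl : ℝ} {K : ℕ}

/-- The weighted sum of the contributions of the clients in a round that starts at `x`. -/
noncomputable def aggregate {𝒮 Ξ : Type*} (wt : 𝒮 → Fin n → ℝ)
    (g : Fin n → Model d → Ξ → Model d) (ηl : ℝ) (K : ℕ) (s : 𝒮) (z : Fin n → ℕ → Ξ)
    (x : Model d) : Model d :=
  ∑ i, wt s i • (localModel (g i) ηl (z i) x K - x)

theorem measurable_aggregate {m : MeasurableSpace Ω} (hwt : ∀ i, Measurable (fun s => wt s i))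
    (hg : ∀ i, Measurable (fun q : Model d × Ξ => g i q.1 q.2)) {s : Ω → 𝒮} (hs : Measurable s)
    {z : Ω → Fin n → ℕ → Ξ} (hz : ∀ i k, Measurable (fun a => z a i k)) {X : Ω → Model d}
    (hX : Measurable X) : Measurable (fun a => aggregate wt g ηl K (s a) (z a) (X a)) := by
  refine Finset.measurable_sum _ fun i _ => ((hwt i).comp hs).smul (Measurable.sub ?_ hX)
  exact measurable_localModel (ξ := fun k a => z a i k) (hg i) hX fun k _ => hz i k

theorem measurable_globalModel {m : MeasurableSpace Ω} (hwt : ∀ i, Measurable (fun s => wt s i))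
    (hg : ∀ i, Measurable (fun q : Model d × Ξ => g i q.1 q.2)) {S : ℕ → Ω → 𝒮}
    {ξ : ℕ → Fin n → ℕ → Ω → Ξ} {t : ℕ} (hS : ∀ s < t, Measurable (S s))
    (hξ : ∀ s < t, ∀ i k, Measurable (ξ s i k)) (θ₀ : Model d) :
    Measurable (fun a => globalModel wt g ηg ηl K θ₀ (fun s => S s a)
      (fun s i k => ξ s i k a) t) := by
  induction t with
  | zero => exact measurable_const
  | succ t ih =>
    have h := ih (fun s hs => hS s (Nat.lt_succ_of_lt hs)) fun s hs => hξ s (Nat.lt_succ_of_lt hs)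
    exact h.add ((measurable_aggregate hwt hg (hS t t.lt_succ_self)
      (z := fun a i k => ξ t i k a) (hξ t t.lt_succ_self) h).const_smul ηg)

end RoundMeasurability

/-! ### Independence of disjoint sources of randomness -/

section RandomnessIndependence

variable {n : ℕ} {Ω 𝒮 Ξ : Type*} [MeasurableSpace 𝒮] [MeasurableSpace Ξ]

/-- The σ-algebras generated by the client samplings and by the batches. -/
abbrev sourceSigma (S : ℕ → Ω → 𝒮) (ξ : ℕ → Fin n → ℕ → Ω → Ξ) :
    ℕ ⊕ (ℕ × Fin n × ℕ) → MeasurableSpace Ω :=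
  Sum.elim (fun t => MeasurableSpace.comap (S t) inferInstance)
    (fun q => MeasurableSpace.comap (ξ q.1 q.2.1 q.2.2) inferInstance)

variable {S : ℕ → Ω → 𝒮} {ξ : ℕ → Fin n → ℕ → Ω → Ξ}

theorem measurable_sampling_biSup {A : Set (ℕ ⊕ (ℕ × Fin n × ℕ))} {t : ℕ} (h : Sum.inl t ∈ A) :
    Measurable[⨆ q ∈ A, sourceSigma S ξ q] (S t) :=
  measurable_biSup_of_comap_le h le_rfl

theorem measurable_batch_biSup {A : Set (ℕ ⊕ (ℕ × Fin n × ℕ))} {t k : ℕ} {i : Fin n}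
    (h : Sum.inr (t, i, k) ∈ A) : Measurable[⨆ q ∈ A, sourceSigma S ξ q] (ξ t i k) :=
  measurable_biSup_of_comap_le h le_rfl

variable [MeasurableSpace Ω] {P : Measure Ω} {ν : Measure 𝒮} {D : Fin n → Measure Ξ}

theorem Randomness.indepFun (h : Randomness P ν D S ξ) {β γ : Type*} [MeasurableSpace β]
    [MeasurableSpace γ] {A B : Set (ℕ ⊕ (ℕ × Fin n × ℕ))} (hAB : Disjoint A B) {X : Ω → β}
    {Y : Ω → γ} (hX : Measurable[⨆ q ∈ A, sourceSigma S ξ q] X)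
    (hY : Measurable[⨆ q ∈ B, sourceSigma S ξ q] Y) : IndepFun X Y P := by
  refine indepFun_of_measurable_biSup ?_ ?_ hAB hX hY
  · rintro (t | q)
    · exact (h.measurable_sampling t).comap_le
    · exact (h.measurable_batch _ _ _).comap_le
  · refine iIndep_sumElim h.iIndep_sampling.iIndep h.iIndep_batch.iIndep ?_
    refine indep_of_indep_of_le_left (indep_of_indep_of_le_right
      ((IndepFun_iff_Indep _ _ _).1 h.indep) ?_) ?_
    · exact iSup_le fun q => Measurable.comap_le (f := ξ q.1 q.2.1 q.2.2)
        ((measurable_pi_apply q).comp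
          (comap_measurable fun a (q : ℕ × Fin n × ℕ) => ξ q.1 q.2.1 q.2.2 a))
    · exact iSup_le fun t => Measurable.comap_le (f := S t)
        ((measurable_pi_apply t).comp (comap_measurable fun a t => S t a))

end RandomnessIndependence

/-- The assumptions on FedAvg. -/
structure Setting {n d : ℕ} {Ω 𝒮 Ξ : Type*} [MeasurableSpace Ω] [MeasurableSpace 𝒮]
    [MeasurableSpace Ξ] (P : Measure Ω) (p : Fin n → ℝ) (loss : Fin n → Model d → ℝ)
    (g : Fin n → Model d → Ξ → Model d) (D : Fin n → Measure Ξ) (wt : 𝒮 → Fin n → ℝ)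
    (ν : Measure 𝒮) (S : ℕ → Ω → 𝒮) (ξ : ℕ → Fin n → ℕ → Ω → Ξ) (L : ℝ≥0)
    (σ β κ α lossInf ηg ηl : ℝ) (K : ℕ) : Prop where
  simplex : p ∈ stdSimplex ℝ (Fin n)
  smooth : Smooth loss L
  gradients : UnbiasedBoundedVariance loss g D σ
  dissimilarity : BoundedDissimilarity p loss β κ
  sampling : ClientSampling p wt ν α
  gam_nonneg : ∀ i, 0 ≤ gam p wt ν α i
  random : Randomness P ν D S ξ
  lossInf_le : ∀ x, lossInf ≤ fedLoss p loss x
  global_pos : 0 < ηg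
  local_pos : 0 < ηl
  one_le_steps : 1 ≤ K
  small_local : 2 * (2 * β ^ 2 + 1) * ηl ^ 2 * (L : ℝ) ^ 2 * (K : ℝ) ^ 2 < 1
  small_global : (L : ℝ) * ηg * ηl * (1 - α) * K < 1
  small_variance : 3 * (L : ℝ) * ηg * ηl * K * (∑ i, gam p wt ν α i) * β ^ 2 ≤ 1

namespace Setting

variable {n d : ℕ} {Ω 𝒮 Ξ : Type*} [MeasurableSpace Ω] [MeasurableSpace 𝒮]
    [MeasurableSpace Ξ] {P : Measure Ω} {p : Fin n → ℝ} {loss : Fin n → Model d → ℝ}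
    {g : Fin n → Model d → Ξ → Model d} {D : Fin n → Measure Ξ} {wt : 𝒮 → Fin n → ℝ}
    {ν : Measure 𝒮} {S : ℕ → Ω → 𝒮} {ξ : ℕ → Fin n → ℕ → Ω → Ξ} {L : ℝ≥0}
    {σ β κ α lossInf ηg ηl : ℝ} {K : ℕ}
    (h : Setting P p loss g D wt ν S ξ L σ β κ α lossInf ηg ηl K)

include h

theorem isClient (t : ℕ) (i : Fin n) :
    IsClient P (∇ (loss i)) (g i) (D i) L σ (ξ t i) where
  lipschitz := h.smooth.lipschitz i
  estimator := ⟨h.gradients.measurable i, h.gradients.memLp i, h.gradients.unbiased i,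
    h.gradients.variance_le i⟩
  measurable k := h.random.measurable_batch t i k
  law k := h.random.law_batch t i k
  iIndep := h.random.iIndep_batch.precomp (g := fun k : ℕ => (t, i, k)) fun a b hab => by
    simpa using hab

/-- Since `β ^ 2 ≥ 1`, the factor `2 * (2 * β ^ 2 + 1)` is at least `6`, and `1 / 6 < (9 / 20) ^ 2`.
-/
theorem local_le : ηl * L * K ≤ 9 / 20 := by
  have h1 := h.small_local
  have hβ := h.dissimilarity.one_le_sq
  have h2 : (ηl * L * K) ^ 2 ≤ (9 / 20) ^ 2 := by
    have h3 : 0 ≤ (ηl * L * K) ^ 2 := by positivity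
    nlinarith
  exact le_of_abs_le (abs_le_of_sq_le_sq h2 (by norm_num))

end Setting

/-- The loss lies between the constant `c` and a quadratic function of `Y`. -/
theorem integrable_comp_of_lipschitzWith_gradient {d : ℕ} {Ω : Type*} [MeasurableSpace Ω]
    {P : Measure Ω} [IsProbabilityMeasure P] {f : Model d → ℝ} {L : ℝ≥0} {c : ℝ}
    (hf : Differentiable ℝ f) (hL : LipschitzWith L (∇ f)) (hc : ∀ x, c ≤ f x)
    {Y : Ω → Model d} (hY : MemLp Y 2 P) : Integrable (fun a => f (Y a)) P := by
  have hup : Integrable (fun a => f 0 + inner ℝ (∇ f 0) (Y a) + L / 2 * ‖Y a‖ ^ 2) P :=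
    ((integrable_const _).add ((hY.integrable (by norm_num)).const_inner _)).add
      ((integrable_norm_sq_of_memLp_two hY).const_mul _)
  refine integrable_of_le_of_le (hf.continuous.comp_aestronglyMeasurable hY.1)
    (Filter.Eventually.of_forall fun a => hc (Y a))
    (Filter.Eventually.of_forall fun a => ?_) (integrable_const c) hup
  simpa using le_of_lipschitzWith_gradient hf hL 0 (Y a)

/-! ### Expected descent in one round from a fixed model -/

namespace Setting

variable {n d : ℕ} {Ω 𝒮 Ξ : Type*} [MeasurableSpace Ω] [MeasurableSpace 𝒮]
    [MeasurableSpace Ξ] {P : Measure Ω} {p : Fin n → ℝ} {loss : Fin n → Model d → ℝ}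
    {g : Fin n → Model d → Ξ → Model d} {D : Fin n → Measure Ξ} {wt : 𝒮 → Fin n → ℝ}
    {ν : Measure 𝒮} {S : ℕ → Ω → 𝒮} {ξ : ℕ → Fin n → ℕ → Ω → Ξ} {L : ℝ≥0}
    {σ β κ α lossInf ηg ηl : ℝ} {K : ℕ}
    (h : Setting P p loss g D wt ν S ξ L σ β κ α lossInf ηg ηl K)

include h

theorem differentiable_fedLoss : Differentiable ℝ (fedLoss p loss) := fun x =>
  (hasGradientAt_fedLoss p h.smooth x).differentiableAt

theorem integrable_fedLoss [IsProbabilityMeasure P] {Y : Ω → Model d} (hY : MemLp Y 2 P) :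
    Integrable (fun a => fedLoss p loss (Y a)) P :=
  integrable_comp_of_lipschitzWith_gradient h.differentiable_fedLoss
    (lipschitzWith_gradient_fedLoss h.simplex h.smooth) h.lossInf_le hY

theorem memLp_weight (t : ℕ) (i : Fin n) : MemLp (fun a => wt (S t a) i) 2 P := by
  have h1 := h.sampling.memLp i
  rw [← h.random.law_sampling t] at h1
  exact h1.comp_of_map (h.random.measurable_sampling t).aemeasurable

theorem integral_sampling (t : ℕ) {f : 𝒮 → ℝ} (hf : Measurable f) :
    ∫ a, f (S t a) ∂P = ∫ s, f s ∂ν := by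
  rw [← h.random.law_sampling t, integral_map (h.random.measurable_sampling t).aemeasurable
    hf.aestronglyMeasurable]

theorem integral_weight_mul_weight [IsProbabilityMeasure P] (t : ℕ) (i j : Fin n) :
    ∫ a, wt (S t a) i * wt (S t a) j ∂P = (1 - α) * (p i * p j) +
      if i = j then Var[fun s => wt s i; ν] + α * p i ^ 2 else 0 := by
  have : IsProbabilityMeasure ν := by
    rw [← h.random.law_sampling t]
    exact Measure.isProbabilityMeasure_map (h.random.measurable_sampling t).aemeasurable
  rw [h.integral_sampling t (f := fun s => wt s i * wt s j)
    ((h.sampling.measurable i).mul (h.sampling.measurable j))]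
  have hcov := covariance_eq_sub (h.sampling.memLp i) (h.sampling.memLp j)
  rw [h.sampling.unbiased, h.sampling.unbiased] at hcov
  simp only [Pi.mul_apply] at hcov
  split_ifs with hij
  · subst hij
    rw [covariance_self (h.sampling.measurable i).aemeasurable] at hcov
    linear_combination -hcov
  · rw [h.sampling.covariance i j hij] at hcov
    linear_combination -hcov

theorem moments_aggregate [IsProbabilityMeasure P] (t : ℕ) (x : Model d) :
    MemLp (fun a => aggregate wt g ηl K (S t a) (fun i k => ξ t i k a) x) 2 P ∧
    ∫ a, aggregate wt g ηl K (S t a) (fun i k => ξ t i k a) x ∂P =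
      ∑ i, p i • (localMean P (g i) ηl (ξ t i) x K - x) ∧
    ∫ a, ‖aggregate wt g ηl K (S t a) (fun i k => ξ t i k a) x‖ ^ 2 ∂P =
      (1 - α) * ‖∑ i, p i • (localMean P (g i) ηl (ξ t i) x K - x)‖ ^ 2 +
      (∑ i, (Var[fun s => wt s i; ν] + p i ^ 2) * localVar P (g i) ηl (ξ t i) x K) +
      ∑ i, gam p wt ν α i * ‖localMean P (g i) ηl (ξ t i) x K - x‖ ^ 2 := by
  have hY := fun i => (h.isClient t i).memLp_localModel (η := ηl) x K
  have hmean : ∀ i, ∫ a, (localModel (g i) ηl (fun k => ξ t i k a) x K - x) ∂P =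
      localMean P (g i) ηl (ξ t i) x K - x := fun i => by
    rw [integral_sub ((hY i).integrable (by norm_num)) (integrable_const _)]
    simp [localMean]
  have hmeas : ∀ i (A : Set (ℕ ⊕ (ℕ × Fin n × ℕ))), (∀ k, Sum.inr (t, i, k) ∈ A) →
      Measurable[⨆ q ∈ A, sourceSigma S ξ q]
        (fun a => localModel (g i) ηl (fun k => ξ t i k a) x K - x) := fun i A hA =>
    (measurable_localModel (h.gradients.measurable i) measurable_const fun k _ =>
      measurable_batch_biSup (hA k)).sub measurable_const
  have key := integral_norm_sq_aggregate (P := P) (W := fun i a => wt (S t a) i)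
    (Δ := fun i a => localModel (g i) ηl (fun k => ξ t i k a) x K - x)
    (h.memLp_weight t)
    (fun i => ((h.isClient t i).measurable_localModel x K).sub measurable_const)
    (fun i => (hY i).sub (memLp_const x))
    (fun i j hij => by
      refine h.random.indepFun
        (A := Set.range fun k => Sum.inr (t, i, k)) (B := Set.range fun k => Sum.inr (t, j, k))
        ?_ (hmeas i _ fun k => ⟨k, rfl⟩) (hmeas j _ fun k => ⟨k, rfl⟩)
      rw [Set.disjoint_left]
      rintro _ ⟨k, rfl⟩ ⟨l, hl⟩
      simp only [Sum.inr.injEq, Prod.mk.injEq] at hl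
      exact hij hl.2.1.symm)
    (by
      refine h.random.indepFun (A := Set.range Sum.inl) (B := Set.range Sum.inr)
        -- The weights use only the sampling sources and the displacements only the batches.
        Set.isCompl_range_inl_range_inr.disjoint ?_ ?_
      · exact @measurable_pi_lambda _ _ _ (_) _ _ fun i => (h.sampling.measurable i).comp
          (measurable_sampling_biSup ⟨t, rfl⟩)
      · exact @measurable_pi_lambda _ _ _ (_) _ _ fun i => hmeas i _ fun k => ⟨(t, i, k), rfl⟩)
    (p := p) (v := fun i => Var[fun s => wt s i; ν]) (α := α)
    (fun i => (h.integral_sampling t (h.sampling.measurable i)).trans (h.sampling.unbiased i))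
    (h.integral_weight_mul_weight t)
  simp only [hmean, sub_sub_sub_cancel_right] at key
  exact key

omit h in
/-- The bound of the squared mean progress of a client with gradient norm `G`. -/
noncomputable def progressBound (L : ℝ≥0) (σ ηl : ℝ) (K : ℕ) (N : ℝ) : ℝ :=
  (K : ℝ) ^ 2 * (ηl ^ 2 * (17 / 8 * N ^ 2 + 26 * L ^ 2 * ((K : ℝ) - 1) * (ηl ^ 2 * σ ^ 2)))

theorem sq_norm_progress_le [IsProbabilityMeasure P] (t : ℕ) (i : Fin n) (x : Model d) :
    ‖localMean P (g i) ηl (ξ t i) x K - x‖ ^ 2 ≤ progressBound L σ ηl K ‖∇ (loss i) x‖ :=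
  (h.isClient t i).sq_norm_localMean_sub_le h.local_pos.le h.local_le h.one_le_steps x le_rfl

theorem sum_var_le [IsProbabilityMeasure P] (t : ℕ) (x : Model d) :
    ∑ i, (Var[fun s => wt s i; ν] + p i ^ 2) * localVar P (g i) ηl (ξ t i) x K ≤
      (∑ i, (Var[fun s => wt s i; ν] + p i ^ 2)) * (3 * K * (ηl ^ 2 * σ ^ 2)) := by
  rw [Finset.sum_mul]
  exact Finset.sum_le_sum fun i _ => mul_le_mul_of_nonneg_left
    ((h.isClient t i).localVar_le h.local_pos.le h.local_le x)
    (add_nonneg (variance_nonneg _ _) (sq_nonneg _))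

/-- The expected decrease of the loss in one round. -/
theorem integral_fedLoss_step_le [IsProbabilityMeasure P] (t : ℕ) (x : Model d) :
    ∫ a, fedLoss p loss (x + ηg • aggregate wt g ηl K (S t a) (fun i k => ξ t i k a) x) ∂P ≤
      fedLoss p loss x - 1 / 20 * (ηg * ηl * K) * ‖∇ (fedLoss p loss) x‖ ^ 2 +
      3 * (ηg * ηl * K) * (L * (ηg * ηl * (∑ i, (Var[fun s => wt s i; ν] + p i ^ 2)) * σ ^ 2) +
        (L : ℝ) ^ 2 * (ηl ^ 2 * ((K : ℝ) - 1) * σ ^ 2) +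
        (L : ℝ) ^ 2 * (ηl ^ 2 * K * ((K : ℝ) - 1) * κ ^ 2) +
        L * (ηg * ηl * (∑ i, gam p wt ν α i) * (((K : ℝ) - 1) * σ ^ 2 + K * κ ^ 2))) := by
  obtain ⟨hA, hmean, hsq⟩ := h.moments_aggregate t x
  have hηl := h.local_pos
  have hηg := h.global_pos
  have hK : (1 : ℝ) ≤ K := by exact_mod_cast h.one_le_steps
  have hK0 : (0 : ℝ) < K := by linarith
  set A := fun a => aggregate wt g ηl K (S t a) (fun i k => ξ t i k a) x with hAdef
  set m : Fin n → Model d := fun i => localMean P (g i) ηl (ξ t i) x K - x with hm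
  set M := ∑ i, p i • m i with hM
  set G := ∇ (fedLoss p loss) x with hG
  set Γ := ∑ i, gam p wt ν α i with hΓ
  set V := ∑ i, (Var[fun s => wt s i; ν] + p i ^ 2) * localVar P (g i) ηl (ξ t i) x K with hV
  set R := ∑ i, gam p wt ν α i * ‖m i‖ ^ 2 with hR
  have hdescent : ∫ a, fedLoss p loss (x + ηg • A a) ∂P ≤
      fedLoss p loss x + ηg * inner ℝ G M + L / 2 * ηg ^ 2 * ((1 - α) * ‖M‖ ^ 2 + V + R) := by
    have hi1 : Integrable (fun a => inner ℝ G (A a)) P :=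
      (hA.integrable (by norm_num)).const_inner _
    have hi2 := integrable_norm_sq_of_memLp_two hA
    have hAx : MemLp (fun a => x + ηg • A a) 2 P := (memLp_const x).add (hA.const_smul ηg)
    calc ∫ a, fedLoss p loss (x + ηg • A a) ∂P
        ≤ ∫ a, (fedLoss p loss x + (ηg * inner ℝ G (A a) + L / 2 * ηg ^ 2 * ‖A a‖ ^ 2)) ∂P := by
          refine integral_mono (h.integrable_fedLoss hAx) ((integrable_const _).add
            ((hi1.const_mul _).add (hi2.const_mul _))) fun a => ?_
          have := le_of_lipschitzWith_gradient h.differentiable_fedLoss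
            (lipschitzWith_gradient_fedLoss h.simplex h.smooth) x (ηg • A a)
          rw [inner_smul_right, norm_smul, mul_pow, Real.norm_eq_abs, sq_abs] at this
          linarith
      _ = _ := by
          rw [integral_add (integrable_const _)
              (by exact (hi1.const_mul _).add (hi2.const_mul _)),
            integral_add (hi1.const_mul _) (hi2.const_mul _), integral_const_mul,
            integral_const_mul, integral_inner (hA.integrable (by norm_num)), hmean, hsq]
          simp
          ring
  have hX : ‖M + (ηl * K) • G‖ ^ 2 ≤ ηl ^ 2 * L ^ 2 * K * (3 / 2 * (K * ((K : ℝ) - 1)) *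
      (ηl ^ 2 * σ ^ 2) + K ^ 2 * ((K : ℝ) - 1) / 3 * (ηl ^ 2 * (17 / 8 *
      (β ^ 2 * ‖G‖ ^ 2 + κ ^ 2) + 26 * L ^ 2 * ((K : ℝ) - 1) * (ηl ^ 2 * σ ^ 2)))) := by
    -- The deviation is a convex combination of client deviations, so convexity of the squared norm
    -- reduces it to the estimate for one client.
    have hcomb : M + (ηl * K) • G = ∑ i, p i • (m i + (ηl * K) • ∇ (loss i) x) := by
      rw [hG, gradient_fedLoss p h.smooth, hM, Finset.smul_sum, ← Finset.sum_add_distrib]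
      exact Finset.sum_congr rfl fun i _ => by rw [smul_add, smul_comm]
    have hdis := h.dissimilarity.bound p h.simplex x
    have hsum := h.simplex.2
    rw [hcomb]
    calc _ ≤ ∑ i, p i * ‖m i + (ηl * K) • ∇ (loss i) x‖ ^ 2 := sq_norm_sum_smul_le h.simplex _
      _ ≤ ∑ i, p i * (ηl ^ 2 * L ^ 2 * K * (3 / 2 * (K * ((K : ℝ) - 1)) * (ηl ^ 2 * σ ^ 2) +
          K ^ 2 * ((K : ℝ) - 1) / 3 * (ηl ^ 2 * (17 / 8 * ‖∇ (loss i) x‖ ^ 2 +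
          26 * L ^ 2 * ((K : ℝ) - 1) * (ηl ^ 2 * σ ^ 2))))) :=
        Finset.sum_le_sum fun i _ => mul_le_mul_of_nonneg_left
          ((h.isClient t i).sq_norm_localMean_sub_add_le hηl.le h.local_le h.one_le_steps x)
          (h.simplex.1 i)
      _ = ηl ^ 2 * L ^ 2 * K * (3 / 2 * (K * ((K : ℝ) - 1)) * (ηl ^ 2 * σ ^ 2) * ∑ i, p i +
          K ^ 2 * ((K : ℝ) - 1) / 3 * (ηl ^ 2 * (17 / 8 * ∑ i, p i * ‖∇ (loss i) x‖ ^ 2 +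
          26 * L ^ 2 * ((K : ℝ) - 1) * (ηl ^ 2 * σ ^ 2) * ∑ i, p i))) := by
        simp only [Finset.mul_sum, ← Finset.sum_add_distrib]
        exact Finset.sum_congr rfl fun i _ => by ring
      _ ≤ _ := by
        rw [hsum, mul_one, mul_one]
        have : (0 : ℝ) ≤ K ^ 2 * ((K : ℝ) - 1) / 3 := by
          have : (0 : ℝ) ≤ (K : ℝ) - 1 := by linarith
          positivity
        gcongr
  have hRle : R ≤ K ^ 2 * (ηl ^ 2 * (17 / 8 * (β ^ 2 * ‖G‖ ^ 2 + κ ^ 2) +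
      26 * L ^ 2 * ((K : ℝ) - 1) * (ηl ^ 2 * σ ^ 2))) * Γ := by
    have hdis := sum_mul_sq_norm_gradient_le h.dissimilarity h.gam_nonneg x
    calc R ≤ ∑ i, gam p wt ν α i * progressBound L σ ηl K ‖∇ (loss i) x‖ :=
          Finset.sum_le_sum fun i _ => mul_le_mul_of_nonneg_left (h.sq_norm_progress_le t i x)
            (h.gam_nonneg i)
      _ = K ^ 2 * (ηl ^ 2 * (17 / 8 * ∑ i, gam p wt ν α i * ‖∇ (loss i) x‖ ^ 2 +
          26 * L ^ 2 * ((K : ℝ) - 1) * (ηl ^ 2 * σ ^ 2) * Γ)) := by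
        simp only [hΓ, Finset.mul_sum, ← Finset.sum_add_distrib, progressBound]
        exact Finset.sum_congr rfl fun i _ => by ring
      _ ≤ K ^ 2 * (ηl ^ 2 * (17 / 8 * ((β ^ 2 * ‖G‖ ^ 2 + κ ^ 2) * Γ) +
          26 * L ^ 2 * ((K : ℝ) - 1) * (ηl ^ 2 * σ ^ 2) * Γ)) := by gcongr
      _ = _ := by ring
  -- Polarization around the displacement of `K` exact gradient steps; its `-‖M‖ ^ 2` term is what
  -- `habs` uses up.
  have hpolar : ηg * inner ℝ G M = ηg / (2 * (ηl * K)) * ‖M + (ηl * K) • G‖ ^ 2 -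
      ηg * (ηl * K) / 2 * ‖G‖ ^ 2 - ηg / (2 * (ηl * K)) * ‖M‖ ^ 2 := by
    rw [norm_add_sq_real, inner_smul_right, norm_smul, mul_pow, Real.norm_eq_abs, sq_abs,
      real_inner_comm]
    field_simp
    ring
  -- Exactly the condition `L * ηg * ηl * (1 - α) * K < 1`; no sign of `1 - α` is needed.
  have habs : L / 2 * ηg ^ 2 * ((1 - α) * ‖M‖ ^ 2) ≤ ηg / (2 * (ηl * K)) * ‖M‖ ^ 2 := by
    rw [← mul_assoc]
    refine mul_le_mul_of_nonneg_right ?_ (sq_nonneg _)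
    rw [le_div_iff₀ (by positivity)]
    have := mul_le_mul_of_nonneg_left h.small_global.le hηg.le
    linarith
  have harith := round_arithmetic hηg hηl L.coe_nonneg hK h.dissimilarity.one_le_sq (sq_nonneg ‖G‖)
    (sq_nonneg κ) (sq_nonneg σ) (Finset.sum_nonneg fun i _ => h.gam_nonneg i)
    (Finset.sum_nonneg fun i _ => add_nonneg (variance_nonneg (fun s => wt s i) ν)
      (sq_nonneg (p i))) h.small_local h.small_variance hX (h.sum_var_le t x) hRle
  rw [← hV, ← hΓ] at harith
  refine hdescent.trans ?_
  linarith

end Setting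

/-! ### Passing from one round to all rounds -/

namespace Setting

variable {n d : ℕ} {Ω 𝒮 Ξ : Type*} [MeasurableSpace Ω] [MeasurableSpace 𝒮]
    [MeasurableSpace Ξ] {P : Measure Ω} {p : Fin n → ℝ} {loss : Fin n → Model d → ℝ}
    {g : Fin n → Model d → Ξ → Model d} {D : Fin n → Measure Ξ} {wt : 𝒮 → Fin n → ℝ}
    {ν : Measure 𝒮} {S : ℕ → Ω → 𝒮} {ξ : ℕ → Fin n → ℕ → Ω → Ξ} {L : ℝ≥0}
    {σ β κ α lossInf ηg ηl : ℝ} {K : ℕ}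

/-- The random global model after `t` rounds. -/
noncomputable abbrev iterate (wt : 𝒮 → Fin n → ℝ) (g : Fin n → Model d → Ξ → Model d)
    (ηg ηl : ℝ) (K : ℕ) (S : ℕ → Ω → 𝒮) (ξ : ℕ → Fin n → ℕ → Ω → Ξ) (θ₀ : Model d) (t : ℕ)
    (a : Ω) : Model d :=
  globalModel wt g ηg ηl K θ₀ (fun s => S s a) (fun s i k => ξ s i k a) t

variable (h : Setting P p loss g D wt ν S ξ L σ β κ α lossInf ηg ηl K)

include h

theorem measurable_iterate (θ₀ : Model d) (t : ℕ) :
    Measurable (iterate wt g ηg ηl K S ξ θ₀ t) :=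
  measurable_globalModel h.sampling.measurable h.gradients.measurable
    (fun s _ => h.random.measurable_sampling s) (fun s _ => h.random.measurable_batch s) θ₀

theorem measurable_round (t : ℕ) :
    Measurable (fun a => (S t a, fun (i : Fin n) (k : ℕ) => ξ t i k a)) :=
  (h.random.measurable_sampling t).prodMk <| measurable_pi_lambda _ fun i =>
    measurable_pi_lambda _ fun k => h.random.measurable_batch t i k

/-- The randomness of a round is independent of the model at its start. -/
theorem indepFun_iterate_round (θ₀ : Model d) (t : ℕ) :
    IndepFun (iterate wt g ηg ηl K S ξ θ₀ t)
      (fun a => (S t a, fun (i : Fin n) (k : ℕ) => ξ t i k a)) P := by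
  -- The sources are sorted by their round index: the model uses rounds before `t`, the round itself
  -- uses index `t`.
  refine h.random.indepFun (A := {q | Sum.elim id (fun r => r.1) q < t})
    (B := {q | Sum.elim id (fun r => r.1) q = t}) ?_ ?_ ?_
  · rw [Set.disjoint_left]
    exact fun q hq hq' => (show Sum.elim id (fun r => r.1) q < t from hq).ne hq'
  · exact measurable_globalModel h.sampling.measurable h.gradients.measurable
      (fun s hs => measurable_sampling_biSup (by simpa using hs))
      (fun s hs i k => measurable_batch_biSup (by simpa using hs)) θ₀
  · refine (measurable_sampling_biSup (by simp)).prodMk ?_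
    exact @measurable_pi_lambda _ _ _ (_) _ _ fun i => @measurable_pi_lambda _ _ _ (_) _ _ fun k =>
      measurable_batch_biSup (by simp)

theorem stronglyMeasurable_aggregate :
    StronglyMeasurable (fun q : Model d × 𝒮 × (Fin n → ℕ → Ξ) =>
      aggregate wt g ηl K q.2.1 q.2.2 q.1) :=
  (measurable_aggregate h.sampling.measurable h.gradients.measurable
    (measurable_fst.comp measurable_snd) (z := fun q : Model d × 𝒮 × (Fin n → ℕ → Ξ) => q.2.2)
    (fun i k => (measurable_pi_apply k).comp
      ((measurable_pi_apply i).comp (measurable_snd.comp measurable_snd)))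
    measurable_fst).stronglyMeasurable

theorem measurable_progressBound (i : Fin n) :
    Measurable (fun x => progressBound L σ ηl K ‖∇ (loss i) x‖) := by
  have := (h.smooth.lipschitz i).continuous
  unfold progressBound
  fun_prop

theorem integrable_progressBound [IsProbabilityMeasure P] {Y : Ω → Model d} (hY : MemLp Y 2 P)
    (i : Fin n) : Integrable (fun a => progressBound L σ ηl K ‖∇ (loss i) (Y a)‖) P :=
  (((integrable_norm_sq_of_memLp_two (memLp_two_comp_of_lipschitzWith (h.smooth.lipschitz i)
    hY)).const_mul _).add (integrable_const _)).const_mul _ |>.const_mul _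

/-- A crude bound that serves only to propagate square integrability: its right side is affine in
the squared client gradients. The absolute value covers `α > 1`. -/
theorem integral_sq_norm_aggregate_le [IsProbabilityMeasure P] (t : ℕ) (x : Model d) :
    ∫ a, ‖aggregate wt g ηl K (S t a) (fun i k => ξ t i k a) x‖ ^ 2 ∂P ≤
      |1 - α| * (∑ i, p i * progressBound L σ ηl K ‖∇ (loss i) x‖) +
      (∑ i, (Var[fun s => wt s i; ν] + p i ^ 2)) * (3 * K * (ηl ^ 2 * σ ^ 2)) +
      ∑ i, gam p wt ν α i * progressBound L σ ηl K ‖∇ (loss i) x‖ := by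
  rw [(h.moments_aggregate t x).2.2]
  refine add_le_add (add_le_add ?_ (h.sum_var_le t x)) (Finset.sum_le_sum fun i _ =>
    mul_le_mul_of_nonneg_left (h.sq_norm_progress_le t i x) (h.gam_nonneg i))
  refine (mul_le_mul_of_nonneg_right (le_abs_self _) (sq_nonneg _)).trans
    (mul_le_mul_of_nonneg_left ?_ (abs_nonneg _))
  exact (sq_norm_sum_smul_le h.simplex _).trans (Finset.sum_le_sum fun i _ =>
    mul_le_mul_of_nonneg_left (h.sq_norm_progress_le t i x) (h.simplex.1 i))

theorem memLp_iterate [IsProbabilityMeasure P] (θ₀ : Model d) (t : ℕ) :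
    MemLp (iterate wt g ηg ηl K S ξ θ₀ t) 2 P := by
  induction t with
  | zero => exact memLp_const θ₀
  | succ t ih =>
    refine ih.add (MemLp.const_smul ?_ ηg)
    refine memLp_two_comp_of_indepFun (h.measurable_iterate θ₀ t) (h.measurable_round t)
      (h.indepFun_iterate_round θ₀ t) h.stronglyMeasurable_aggregate
      (fun x => (h.moments_aggregate t x).1) ?_ ?_ (h.integral_sq_norm_aggregate_le t)
    · exact (((Finset.measurable_sum _ fun i _ =>
        (h.measurable_progressBound i).const_mul _).const_mul _).add_const _).add
        (Finset.measurable_sum _ fun i _ => (h.measurable_progressBound i).const_mul _)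
    · exact (((integrable_finsetSum _ fun i _ =>
        (h.integrable_progressBound ih i).const_mul _).const_mul _).add (integrable_const _)).add
        (integrable_finsetSum _ fun i _ => (h.integrable_progressBound ih i).const_mul _)

theorem integrable_sq_norm_gradient [IsProbabilityMeasure P] (θ₀ : Model d) (t : ℕ) :
    Integrable (fun a => ‖∇ (fedLoss p loss) (iterate wt g ηg ηl K S ξ θ₀ t a)‖ ^ 2) P :=
  integrable_norm_sq_of_memLp_two (memLp_two_comp_of_lipschitzWith
    (lipschitzWith_gradient_fedLoss h.simplex h.smooth) (h.memLp_iterate θ₀ t))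

omit h in
/-- The error terms of the convergence bound. -/
noncomputable def errorTerms (p : Fin n → ℝ) (wt : 𝒮 → Fin n → ℝ) (ν : Measure 𝒮) (L : ℝ≥0)
    (σ κ α ηg ηl : ℝ) (K : ℕ) : ℝ :=
  L * (ηg * ηl * (∑ i, (Var[fun s => wt s i; ν] + p i ^ 2)) * σ ^ 2) +
    (L : ℝ) ^ 2 * (ηl ^ 2 * ((K : ℝ) - 1) * σ ^ 2) +
    (L : ℝ) ^ 2 * (ηl ^ 2 * K * ((K : ℝ) - 1) * κ ^ 2) +
    L * (ηg * ηl * (∑ i, gam p wt ν α i) * (((K : ℝ) - 1) * σ ^ 2 + K * κ ^ 2))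

theorem errorTerms_nonneg : 0 ≤ errorTerms p wt ν L σ κ α ηg ηl K := by
  have hηl := h.local_pos
  have hηg := h.global_pos
  have hK : (0 : ℝ) ≤ (K : ℝ) - 1 := by
    have : (1 : ℝ) ≤ K := by exact_mod_cast h.one_le_steps
    linarith
  have h1 : 0 ≤ ∑ i, (Var[fun s => wt s i; ν] + p i ^ 2) := Finset.sum_nonneg fun i _ =>
    add_nonneg (variance_nonneg _ _) (sq_nonneg _)
  have h2 : 0 ≤ ∑ i, gam p wt ν α i := Finset.sum_nonneg fun i _ => h.gam_nonneg i
  unfold errorTerms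
  positivity

/-- Fubini freezes the model at the start of the round, so the one-round estimate applies pointwise
and is then integrated. -/
theorem integral_fedLoss_iterate_succ_le [IsProbabilityMeasure P] (θ₀ : Model d) (t : ℕ) :
    ∫ a, fedLoss p loss (iterate wt g ηg ηl K S ξ θ₀ (t + 1) a) ∂P ≤
      ∫ a, fedLoss p loss (iterate wt g ηg ηl K S ξ θ₀ t a) ∂P -
      1 / 20 * (ηg * ηl * K) *
        ∫ a, ‖∇ (fedLoss p loss) (iterate wt g ηg ηl K S ξ θ₀ t a)‖ ^ 2 ∂P +
      3 * (ηg * ηl * K) * errorTerms p wt ν L σ κ α ηg ηl K := by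
  have hF : StronglyMeasurable (fun q : Model d × 𝒮 × (Fin n → ℕ → Ξ) =>
      fedLoss p loss (q.1 + ηg • aggregate wt g ηl K q.2.1 q.2.2 q.1)) :=
    h.differentiable_fedLoss.continuous.comp_stronglyMeasurable
      (measurable_fst.stronglyMeasurable.add (h.stronglyMeasurable_aggregate.const_smul ηg))
  obtain ⟨hi, heq⟩ := integral_comp_of_indepFun (h.measurable_iterate θ₀ t)
    (h.measurable_round t) (h.indepFun_iterate_round θ₀ t) hF
    (h.integrable_fedLoss (h.memLp_iterate θ₀ (t + 1)))
  refine (le_of_eq heq).trans ?_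
  have h1 := h.integrable_fedLoss (h.memLp_iterate θ₀ t)
  have h2 := (h.integrable_sq_norm_gradient θ₀ t).const_mul (1 / 20 * (ηg * ηl * K))
  calc _ ≤ ∫ a, (fedLoss p loss (iterate wt g ηg ηl K S ξ θ₀ t a) - 1 / 20 * (ηg * ηl * K) *
        ‖∇ (fedLoss p loss) (iterate wt g ηg ηl K S ξ θ₀ t a)‖ ^ 2 +
        3 * (ηg * ηl * K) * errorTerms p wt ν L σ κ α ηg ηl K) ∂P :=
        integral_mono hi ((h1.sub h2).add (integrable_const _)) fun a =>
          h.integral_fedLoss_step_le t _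
    _ = _ := by
        rw [integral_add (by exact h1.sub h2) (integrable_const _), integral_sub h1 h2,
          integral_const_mul]
        simp

theorem average_le [IsProbabilityMeasure P] (θ₀ : Model d) {T : ℕ} (hT : 1 ≤ T) :
    (1 / (T : ℝ)) * ∑ t ∈ Finset.range T,
        ∫ a, ‖∇ (fedLoss p loss) (iterate wt g ηg ηl K S ξ θ₀ t a)‖ ^ 2 ∂P ≤
      60 * ((fedLoss p loss θ₀ - lossInf) / (ηg * ηl * K * T) +
        errorTerms p wt ν L σ κ α ηg ηl K) := by
  set E := errorTerms p wt ν L σ κ α ηg ηl K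
  set I : ℕ → ℝ := fun t =>
    ∫ a, ‖∇ (fedLoss p loss) (iterate wt g ηg ηl K S ξ θ₀ t a)‖ ^ 2 ∂P
  have hηl := h.local_pos
  have hηg := h.global_pos
  have hK : (0 : ℝ) < K := by exact_mod_cast h.one_le_steps
  have hT0 : (0 : ℝ) < T := by exact_mod_cast hT
  have htel : ∀ t : ℕ, ∫ a, fedLoss p loss (iterate wt g ηg ηl K S ξ θ₀ t a) ∂P ≤
      fedLoss p loss θ₀ - 1 / 20 * (ηg * ηl * K) * ∑ s ∈ Finset.range t, I s +
        t * (3 * (ηg * ηl * K) * E) := by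
    intro t
    induction t with
    | zero => simp [iterate, globalModel]
    | succ t ih =>
      rw [Finset.sum_range_succ]
      push_cast
      linarith [h.integral_fedLoss_iterate_succ_le θ₀ t]
  have hlow : lossInf ≤ ∫ a, fedLoss p loss (iterate wt g ηg ηl K S ξ θ₀ T a) ∂P := by
    have := integral_mono (integrable_const lossInf)
      (h.integrable_fedLoss (h.memLp_iterate θ₀ T)) fun a => h.lossInf_le _
    simpa using this
  have hmain := hlow.trans (htel T)
  have hgap : 0 ≤ (fedLoss p loss θ₀ - lossInf) / (ηg * ηl * K * T) :=
    div_nonneg (sub_nonneg.2 (h.lossInf_le θ₀)) (by positivity)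
  have hE : 0 ≤ E := h.errorTerms_nonneg
  -- Dividing by the descent rate `1 / 20` gives `20` for the initial gap and `20 * 3 = 60` for the
  -- errors; the gap is nonnegative, so `60` serves for both.
  have h20 : (1 / (T : ℝ)) * ∑ t ∈ Finset.range T, I t ≤
      20 * ((fedLoss p loss θ₀ - lossInf) / (ηg * ηl * K * T)) + 60 * E := by
    have e : 20 * ((fedLoss p loss θ₀ - lossInf) / (ηg * ηl * K * T)) + 60 * E =
        (20 * (fedLoss p loss θ₀ - lossInf) + T * (60 * (ηg * ηl * K) * E)) /
          (ηg * ηl * K * T) := by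
      field_simp
    rw [e, le_div_iff₀ (by positivity)]
    have e2 : 1 / (T : ℝ) * (∑ t ∈ Finset.range T, I t) * (ηg * ηl * K * T) =
        ηg * ηl * K * ∑ t ∈ Finset.range T, I t := by
      field_simp
    rw [e2]
    linarith
  linarith

end Setting

end FedAvg

theorem mainTheorem1 :
    ∃ C : ℝ, 0 < C ∧
      ∀ (n d : ℕ) (Ω 𝒮 Ξ : Type*) [MeasurableSpace Ω] [MeasurableSpace 𝒮] [MeasurableSpace Ξ]
        (P : Measure Ω) [IsProbabilityMeasure P]
        (p : Fin n → ℝ) (loss : Fin n → FedAvg.Model d → ℝ)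
        (g : Fin n → FedAvg.Model d → Ξ → FedAvg.Model d) (D : Fin n → Measure Ξ)
        (wt : 𝒮 → Fin n → ℝ) (ν : Measure 𝒮)
        (S : ℕ → Ω → 𝒮) (ξ : ℕ → Fin n → ℕ → Ω → Ξ)
        (L : ℝ≥0) (σ β κ α lossInf ηg ηl : ℝ) (K T : ℕ) (θ₀ : FedAvg.Model d),
        p ∈ stdSimplex ℝ (Fin n) →
        FedAvg.Smooth loss L →
        FedAvg.UnbiasedBoundedVariance loss g D σ →
        FedAvg.BoundedDissimilarity p loss β κ →
        FedAvg.ClientSampling p wt ν α →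
        (∀ i, 0 ≤ FedAvg.gam p wt ν α i) →
        FedAvg.Randomness P ν D S ξ →
        (∀ x, lossInf ≤ FedAvg.fedLoss p loss x) →
        0 < ηg → 0 < ηl → 1 ≤ K → 1 ≤ T →
        2 * (2 * β ^ 2 + 1) * ηl ^ 2 * (L : ℝ) ^ 2 * (K : ℝ) ^ 2 < 1 →
        (L : ℝ) * ηg * ηl * (1 - α) * K < 1 →
        3 * (L : ℝ) * ηg * ηl * K * (∑ i, FedAvg.gam p wt ν α i) * β ^ 2 ≤ 1 →
        (∀ t, Integrable (fun a => ‖∇ (FedAvg.fedLoss p loss)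
          (FedAvg.globalModel wt g ηg ηl K θ₀ (fun s => S s a) (fun s i k => ξ s i k a) t)‖ ^ 2)
          P) ∧
        (1 / (T : ℝ)) * ∑ t ∈ Finset.range T, ∫ a, ‖∇ (FedAvg.fedLoss p loss)
            (FedAvg.globalModel wt g ηg ηl K θ₀ (fun s => S s a) (fun s i k => ξ s i k a) t)‖ ^ 2
            ∂P
          ≤ C * ((FedAvg.fedLoss p loss θ₀ - lossInf) / (ηg * ηl * K * T)
            + L * (ηg * ηl * (∑ i, (Var[fun s => wt s i; ν] + p i ^ 2)) * σ ^ 2)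
            + (L : ℝ) ^ 2 * (ηl ^ 2 * ((K : ℝ) - 1) * σ ^ 2)
            + (L : ℝ) ^ 2 * (ηl ^ 2 * K * ((K : ℝ) - 1) * κ ^ 2)
            + L * (ηg * ηl * ((∑ i, Var[fun s => wt s i; ν]) + α * (∑ i, p i ^ 2))
                * (((K : ℝ) - 1) * σ ^ 2 + K * κ ^ 2))) := by
  refine ⟨60, by norm_num, ?_⟩
  intro n d Ω 𝒮 Ξ _ _ _ P _ p loss g D wt ν S ξ L σ β κ α lossInf ηg ηl K T θ₀ hp hsm hg hdis
    hcs hγ hR hinf hηg hηl hK hT h1 h2 h3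
  have h : FedAvg.Setting P p loss g D wt ν S ξ L σ β κ α lossInf ηg ηl K :=
    ⟨hp, hsm, hg, hdis, hcs, hγ, hR, hinf, hηg, hηl, hK, h1, h2, h3⟩
  refine ⟨h.integrable_sq_norm_gradient θ₀, (h.average_le θ₀ hT).trans (le_of_eq ?_)⟩
  have hΓ : ∑ i, FedAvg.gam p wt ν α i =
      (∑ i, Var[fun s => wt s i; ν]) + α * ∑ i, p i ^ 2 := by
    rw [Finset.mul_sum, ← Finset.sum_add_distrib]
    rfl
  rw [FedAvg.Setting.errorTerms, hΓ]
  ring
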